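/- Let $C$ be an ordered field. A *$2$-ordered $C$-vector space* is a $C$-vector space $G$ with two strict total orderings $<_0,<_1$ such that for $i=0,1$: $x<_i y$ implies $x+z<_i y+z$, and $0<_i x$ implies $0<_i\lambda x$ for all $\lambda\in C$ with $\lambda>0$. Put $G_\infty:=G\cup\{\infty\}$ with $\infty\notin G$, and extend both orderings to $G_\infty$ by $G<_i\infty$. A *Hamel valuation* on $G$ is a map $v:G\to G_\infty$, extended by $v(\infty):=\infty$, such that for all $x,y\in G$ and $\lambda\in C\setminus\{0\}$: 1. $v(x)=\infty$ if and only if $x=0$; $v(x+y)\geq_0\min_0(v(x),v(y))$; $v(\lambda x)=v(x)$; and if $0<_1x<_1y$, then $v(x)\geq_0v(y)$; 2. $v(v(x))=v(x)$; 3. $v(x)>_10$. A *Hamel space over $C$* is such a pair $(G,v)$. It is *independent* if for all $a_0<_0b_0$ and $a_1<_1b_1$ with $a_i,b_i\in G\cup\{-\infty,\infty\}$ (where $-\infty<_iG<_i\infty$) there is $x\in G$ with $a_0<_0x<_0b_0$ and $a_1<_1x<_1b_1$. It is *dense* if for all $a,b\in G$ with $a<_0b$ there is $c\in G$ with $a<_0v(c)<_0b$.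 Let $\mathcal L_{\mathrm{Ham}}=\{0,+,(\lambda_c)_{c\in C},<_0,<_1,v,\infty\}$. A Hamel space $(G,v)$ is viewed as an $\mathcal L_{\mathrm{Ham}}$-structure with underlying set $G_\infty$, where $\lambda_c$ is multiplication by $c$ on $G$, the other symbols have the obvious interpretation, and $g+\infty=\infty+g=\infty+\infty=\lambda_c(\infty)=v(\infty)=\infty$ for $g\in G$, $c\in C$. Let $T_{\mathrm{Ham}}$ be the $\mathcal L_{\mathrm{Ham}}$-theory whose models are (up to isomorphism) the independent and dense Hamel spaces over $C$. **Corollary.** $T_{\mathrm{Ham}}$ has the non-independence property (NIP): there are no $\mathcal L_{\mathrm{Ham}}$-formula $\varphi(x;y)$ in finite tuples of variables $x,y$, model $M$ of $T_{\mathrm{Ham}}$, and tuples $(a_i)_{i\in\mathbb N}$ in $M^{x}$ and $(b_J)_{J\subseteq\mathbb N}$ in $M^{y}$ such that for all $i\in\mathbb N$ and $J\subseteq\mathbb N$: $M\models\varphi(a_i;b_J)$ if and only if $i\in J$. -/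

import Mathlib

open FirstOrder FirstOrder.Language

universe u v w

section ModelTheory

/-- A partitioned formula `φ(x; y)`, in finite tuples of variables `x` and `y`, has the independence
property in the theory `T` if in some model of `T` there are tuples `a i` (`i ∈ ℕ`) and
`b J` (`J ⊆ ℕ`) such that `φ(a i; b J)` holds if and only if `i ∈ J`. -/
def HasIP {L : FirstOrder.Language.{u, v}} (T : L.Theory) {m n : ℕ} (φ : L.Formula (Fin m ⊕ Fin n)) : Prop :=
  ∃ (M : Theory.ModelType.{u, v, max u v w} T) (a : ℕ → Fin m → M) (b : Set ℕ → Fin n → M),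
    ∀ (i : ℕ) (J : Set ℕ), φ.Realize (Sum.elim (a i) (b J)) ↔ i ∈ J

/-- A theory is NIP if no partitioned formula has the independence property in it. -/
def IsNIP {L : FirstOrder.Language.{u, v}} (T : L.Theory) : Prop :=
  ∀ (m n : ℕ) (φ : L.Formula (Fin m ⊕ Fin n)), ¬ HasIP.{u, v, w} T φ

end ModelTheory

section Spaces

/-- The extension of a relation `r` on `G` to `G ∪ {∞}`, by `x < ∞` for `x` in `G`. -/
def topLT {G : Type*} (r : G → G → Prop) (a b : WithTop G) : Prop :=
  letI : LT G := ⟨r⟩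
  a < b

/-- The reflexive closure of `topLT r`. -/
def topLE {G : Type*} (r : G → G → Prop) (a b : WithTop G) : Prop :=
  topLT r a b ∨ a = b

/-- The extension of a relation `r` on `G` to `G ∪ {-∞, ∞}`, by `-∞ < x < ∞` for `x` in `G`. -/
def botTopLT {G : Type*} (r : G → G → Prop) (a b : WithBot (WithTop G)) : Prop :=
  letI : LT G := ⟨r⟩
  a < b

/-- A family of orderings on `G` is independent if finitely many intervals
`(a_i, b_i)_i` with `a_i <_i b_i` in `G ∪ {-∞, ∞}`, for distinct indices `i`, always meet in `G`. -/
def IndependentOrderings {I G : Type*} (lt : I → G → G → Prop) : Prop :=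
  ∀ (S : Finset I) (a b : I → WithBot (WithTop G)),
    (∀ i ∈ S, botTopLT (lt i) (a i) (b i)) →
      ∃ x : G, ∀ i ∈ S, botTopLT (lt i) (a i) ((x : WithTop G) : WithBot (WithTop G)) ∧
        botTopLT (lt i) ((x : WithTop G) : WithBot (WithTop G)) (b i)

/-- An `I`-ordering on the `C`-vector space `G` that makes `G` an `I`-ordered `C`-vector space:
each `lt i` is a strict total ordering, which makes `G` an ordered `C`-vector space. -/
structure IOrderedSpace (I : Type*) (C : Type*) [Field C] [LinearOrder C] [IsStrictOrderedRing C]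
    (G : Type*) [AddCommGroup G] [Module C G] where
  lt : I → G → G → Prop
  lt_irrefl : ∀ i x, ¬ lt i x x
  lt_trans : ∀ i x y z, lt i x y → lt i y z → lt i x z
  lt_total : ∀ i x y, lt i x y ∨ x = y ∨ lt i y x
  add_lt_add : ∀ i x y z, lt i x y → lt i (x + z) (y + z)
  smul_pos : ∀ i (c : C) x, 0 < c → lt i 0 x → lt i 0 (c • x)

/-- The Hamel space structures on the `C`-vector space `G`: two orderings `lt 0` and `lt 1` that
make `G` a `2`-ordered `C`-vector space, and a Hamel valuation `v : G → G ∪ {∞}`. -/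
structure HamelSpace (C : Type*) [Field C] [LinearOrder C] [IsStrictOrderedRing C]
    (G : Type*) [AddCommGroup G] [Module C G] extends IOrderedSpace (Fin 2) C G where
  v : G → WithTop G
  v_eq_top_iff : ∀ x, v x = ⊤ ↔ x = 0
  /-- `v (x + y) ≥ min (v x) (v y)` with respect to the ordering `lt 0`. -/
  v_add : ∀ x y, topLE (lt 0) (v x) (v (x + y)) ∨ topLE (lt 0) (v y) (v (x + y))
  v_smul : ∀ (c : C) x, c ≠ 0 → v (c • x) = v x
  v_convex : ∀ x y, lt 1 0 x → lt 1 x y → topLE (lt 0) (v y) (v x)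
  /-- `v (v x) = v x`, where `v ∞ = ∞`. -/
  v_idem : ∀ x, (v x).recTopCoe ⊤ v = v x
  v_pos : ∀ x, topLT (lt 1) ((0 : G) : WithTop G) (v x)

variable {C : Type*} [Field C] [LinearOrder C] [IsStrictOrderedRing C]
  {G : Type*} [AddCommGroup G] [Module C G]

/-- The two orderings of the Hamel space are independent. -/
def HamelSpace.IsIndependent (H : HamelSpace C G) : Prop := IndependentOrderings H.lt

/-- The set of values of the Hamel space is dense in its first ordering. -/
def HamelSpace.IsDense (H : HamelSpace C G) : Prop :=
  ∀ a b : G, H.lt 0 a b → ∃ c : G, topLT (H.lt 0) a (H.v c) ∧ topLT (H.lt 0) (H.v c) b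

end Spaces

section LanguageHam

/-- The function symbols `0`, `∞`, `+`, `v` and the scalar multiplications `λ_c`. -/
inductive HamFunc (C : Type u) : ℕ → Type u
  | zero : HamFunc C 0
  | infty : HamFunc C 0
  | add : HamFunc C 2
  | smul (c : C) : HamFunc C 1
  | val : HamFunc C 1

/-- The relation symbols `<_0` and `<_1`. -/
inductive HamRel : ℕ → Type
  | lt (i : Fin 2) : HamRel 2

/-- The language of Hamel spaces over `C`. -/
def langHam (C : Type u) : FirstOrder.Language.{u, 0} := ⟨HamFunc C, HamRel⟩

/-- A Hamel space as a structure with underlying set `G ∪ {∞}`, with `∞` as a default value. -/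
@[reducible]
def HamelSpace.toStructure {C : Type u} [Field C] [LinearOrder C] [IsStrictOrderedRing C]
    {G : Type w} [AddCommGroup G] [Module C G] (H : HamelSpace C G) :
    (langHam C).Structure (WithTop G) where
  funMap := fun {_} f =>
    match f with
    | .zero => fun _ => ((0 : G) : WithTop G)
    | .infty => fun _ => ⊤
    | .add => fun x => x 0 + x 1
    | .smul c => fun x => (x 0).map (c • ·)
    | .val => fun x => (x 0).recTopCoe ⊤ H.v
  RelMap := fun {_} r =>
    match r with
    | .lt i => fun x => topLT (H.lt i) (x 0) (x 1)

namespace Ham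

variable {C : Type u} {α : Type w} {n : ℕ}

/-- The symbol `0` of `langHam C`. -/
abbrev zeroS : (langHam C).Constants := HamFunc.zero

/-- The symbol `∞` of `langHam C`. -/
abbrev inftyS : (langHam C).Constants := HamFunc.infty

/-- The symbol `+` of `langHam C`. -/
abbrev addS : (langHam C).Functions 2 := HamFunc.add

/-- The symbol `λ_c` of `langHam C`. -/
abbrev smulS (c : C) : (langHam C).Functions 1 := HamFunc.smul c

/-- The symbol `v` of `langHam C`. -/
abbrev valS : (langHam C).Functions 1 := HamFunc.val

variable (C) in
/-- The symbol `<_i` of `langHam C`. -/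
abbrev ltS (i : Fin 2) : (langHam C).Relations 2 := HamRel.lt i

/-- The term `0`. -/
def zeroT : (langHam C).Term α := Constants.term zeroS

/-- The term `∞`. -/
def inftyT : (langHam C).Term α := Constants.term inftyS

/-- The term `s + t`. -/
def addT (s t : (langHam C).Term α) : (langHam C).Term α :=
  Functions.apply₂ addS s t

/-- The term `λ_c t`. -/
def smulT (c : C) (t : (langHam C).Term α) : (langHam C).Term α :=
  Functions.apply₁ (smulS c) t

/-- The term `v t`. -/
def valT (t : (langHam C).Term α) : (langHam C).Term α :=
  Functions.apply₁ valS t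

/-- The formula `s <_i t`. -/
def ltF (i : Fin 2) (s t : (langHam C).Term (α ⊕ Fin n)) : (langHam C).BoundedFormula α n :=
  Relations.boundedFormula₂ (ltS C i) s t

/-- The formula `t ≠ ∞`. -/
def finF (t : (langHam C).Term (α ⊕ Fin n)) : (langHam C).BoundedFormula α n :=
  ∼(t =' inftyT)

/-- The formula `s <_i t`, where `s` is to be read as `-∞` if `p` is true. -/
def lowF (p : Bool) (i : Fin 2) (s t : (langHam C).Term (α ⊕ Fin n)) :
    (langHam C).BoundedFormula α n :=
  if p then ⊤ else ltF i s t

end Ham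

/-- Names for the axioms of the theory of independent and dense Hamel spaces over `C`. -/
inductive HamAxiom (C : Type u) [Zero C] [LT C] : Type u
  | ltIrrefl (i : Fin 2)
  | ltTrans (i : Fin 2)
  | ltTotal (i : Fin 2)
  | ltInfty (i : Fin 2)
  | zeroFin
  | addFin
  | smulFin (c : C)
  | addInfty
  | smulInfty (c : C)
  | valInfty
  | addComm
  | addAssoc
  | zeroAdd
  | addNeg
  | smulAdd (c : C)
  | addSMul (c d : C)
  | mulSMul (c d : C)
  | oneSMul
  | addLT (i : Fin 2)
  | smulPos (i : Fin 2) (c : C) (hc : 0 < c)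
  | valZero
  | valFin
  | valAdd
  | valSMul (c : C) (hc : c ≠ 0)
  | valConvex
  | valIdem
  | valPos
  | dense
  | indep (p q : Bool)

open Ham in
/-- The axioms themselves. The variables range over `G ∪ {∞}`, whence the guards `finF`. -/
def HamAxiom.toSentence {C : Type u} [Field C] [LinearOrder C] :
    HamAxiom C → (langHam C).Sentence
  | .ltIrrefl i => ∀' ∼(ltF i (&0) (&0))
  | .ltTrans i => ∀' ∀' ∀' (ltF i (&0) (&1) ⟹ ltF i (&1) (&2) ⟹ ltF i (&0) (&2))
  | .ltTotal i => ∀' ∀' (ltF i (&0) (&1) ⊔ ((&0) =' (&1) ⊔ ltF i (&1) (&0)))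
  | .ltInfty i => ∀' (finF (&0) ⟹ ltF i (&0) inftyT)
  | .zeroFin => finF zeroT
  | .addFin => ∀' ∀' (finF (&0) ⟹ finF (&1) ⟹ finF (addT (&0) (&1)))
  | .smulFin c => ∀' (finF (&0) ⟹ finF (smulT c (&0)))
  | .addInfty => ∀' (addT (&0) inftyT =' inftyT)
  | .smulInfty c => smulT c inftyT =' inftyT
  | .valInfty => valT inftyT =' inftyT
  | .addComm => ∀' ∀' (addT (&0) (&1) =' addT (&1) (&0))
  | .addAssoc => ∀' ∀' ∀' (addT (addT (&0) (&1)) (&2) =' addT (&0) (addT (&1) (&2)))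
  | .zeroAdd => ∀' (addT zeroT (&0) =' (&0))
  | .addNeg => ∀' (finF (&0) ⟹ addT (&0) (smulT (-1) (&0)) =' zeroT)
  | .smulAdd c => ∀' ∀' (smulT c (addT (&0) (&1)) =' addT (smulT c (&0)) (smulT c (&1)))
  | .addSMul c d => ∀' (smulT (c + d) (&0) =' addT (smulT c (&0)) (smulT d (&0)))
  | .mulSMul c d => ∀' (smulT (c * d) (&0) =' smulT c (smulT d (&0)))
  | .oneSMul => ∀' (smulT 1 (&0) =' (&0))
  | .addLT i => ∀' ∀' ∀' (finF (&0) ⟹ finF (&1) ⟹ finF (&2) ⟹ ltF i (&0) (&1) ⟹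
      ltF i (addT (&0) (&2)) (addT (&1) (&2)))
  | .smulPos i c _ => ∀' (finF (&0) ⟹ ltF i zeroT (&0) ⟹ ltF i zeroT (smulT c (&0)))
  | .valZero => valT zeroT =' inftyT
  | .valFin => ∀' (finF (&0) ⟹ ∼((&0) =' zeroT) ⟹ finF (valT (&0)))
  | .valAdd => ∀' ∀' (finF (&0) ⟹ finF (&1) ⟹
      (∼(ltF 0 (valT (addT (&0) (&1))) (valT (&0))) ⊔
        ∼(ltF 0 (valT (addT (&0) (&1))) (valT (&1)))))
  | .valSMul c _ => ∀' (finF (&0) ⟹ valT (smulT c (&0)) =' valT (&0))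
  | .valConvex => ∀' ∀' (finF (&0) ⟹ finF (&1) ⟹ ltF 1 zeroT (&0) ⟹ ltF 1 (&0) (&1) ⟹
      ∼(ltF 0 (valT (&0)) (valT (&1))))
  | .valIdem => ∀' (finF (&0) ⟹ valT (valT (&0)) =' valT (&0))
  | .valPos => ∀' (finF (&0) ⟹ ltF 1 zeroT (valT (&0)))
  | .dense => ∀' ∀' (finF (&0) ⟹ finF (&1) ⟹ ltF 0 (&0) (&1) ⟹
      ∃' (finF (&2) ⊓ (ltF 0 (&0) (valT (&2)) ⊓ ltF 0 (valT (&2)) (&1))))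
  | .indep p q => ∀' ∀' ∀' ∀' (lowF p 0 (&0) (&1) ⟹ lowF q 1 (&2) (&3) ⟹
      ∃' (finF (&4) ⊓ ((lowF p 0 (&0) (&4) ⊓ ltF 0 (&4) (&1)) ⊓
        (lowF q 1 (&2) (&4) ⊓ ltF 1 (&4) (&3)))))

/-- The theory whose models are the independent and dense Hamel spaces over `C`,
see `THam_models_iff`. -/
def THam (C : Type u) [Field C] [LinearOrder C] : (langHam C).Theory :=
  Set.range (HamAxiom.toSentence (C := C))

end LanguageHam

section Models

namespace Ham

variable {C : Type u} {M : Type w} [(langHam C).Structure M]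

variable (C M) in
/-- The interpretation of `0`. -/
def zeroM : M := Structure.funMap (L := langHam C) (M := M) zeroS ![]

variable (C M) in
/-- The interpretation of `∞`. -/
def inftyM : M := Structure.funMap (L := langHam C) (M := M) inftyS ![]

variable (C) in
/-- The interpretation of `+`. -/
def addM (x y : M) : M := Structure.funMap (addS (C := C)) ![x, y]

/-- The interpretation of `λ_c`. -/
def smulM (c : C) (x : M) : M :=
  Structure.funMap (smulS c) ![x]

variable (C) in
/-- The interpretation of `v`. -/
def valM (x : M) : M := Structure.funMap (valS (C := C)) ![x]

variable (C) in
/-- The interpretation of `<_i`. -/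
def ltM (i : Fin 2) (x y : M) : Prop :=
  Structure.RelMap (ltS C i) ![x, y]

variable {α : Type*} {n : ℕ} (e : α → M) (xs : Fin n → M)

theorem realize_zeroT : (zeroT : (langHam C).Term α).realize e = zeroM C M := by
  rw [zeroT, Term.realize_constants, zeroM, constantMap]
  exact congrArg _ (Subsingleton.elim _ _)

theorem realize_inftyT : (inftyT : (langHam C).Term α).realize e = inftyM C M := by
  rw [inftyT, Term.realize_constants, inftyM, constantMap]
  exact congrArg _ (Subsingleton.elim _ _)

theorem realize_addT (s t : (langHam C).Term α) :
    (addT s t).realize e = addM C (s.realize e) (t.realize e) :=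
  Term.realize_functions_apply₂

theorem realize_smulT (c : C) (t : (langHam C).Term α) :
    (smulT c t).realize e = smulM c (t.realize e) :=
  Term.realize_functions_apply₁

theorem realize_valT (t : (langHam C).Term α) : (valT t).realize e = valM C (t.realize e) :=
  Term.realize_functions_apply₁

theorem realize_ltF (i : Fin 2) (s t : (langHam C).Term (α ⊕ Fin n)) :
    (ltF i s t).Realize e xs ↔
      ltM C i (s.realize (Sum.elim e xs)) (t.realize (Sum.elim e xs)) :=
  BoundedFormula.realize_rel₂

theorem realize_finF (t : (langHam C).Term (α ⊕ Fin n)) :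
    (finF t).Realize e xs ↔ t.realize (Sum.elim e xs) ≠ inftyM C M := by
  simp [finF, realize_inftyT]

theorem realize_lowF (p : Bool) (i : Fin 2) (s t : (langHam C).Term (α ⊕ Fin n)) :
    (lowF p i s t).Realize e xs ↔
      (p = true ∨ ltM C i (s.realize (Sum.elim e xs)) (t.realize (Sum.elim e xs))) := by
  cases p <;> simp [lowF, realize_ltF]

end Ham

open Ham in
/-- What each axiom says in a structure. -/
def HamAxiom.Holds {C : Type u} [Field C] [LinearOrder C] (M : Type w) [(langHam C).Structure M] :
    HamAxiom C → Prop
  | .ltIrrefl i => ∀ x : M, ¬ ltM C i x x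
  | .ltTrans i => ∀ x y z : M, ltM C i x y → ltM C i y z → ltM C i x z
  | .ltTotal i => ∀ x y : M, ltM C i x y ∨ x = y ∨ ltM C i y x
  | .ltInfty i => ∀ x : M, x ≠ inftyM C M → ltM C i x (inftyM C M)
  | .zeroFin => zeroM C M ≠ inftyM C M
  | .addFin => ∀ x y : M, x ≠ inftyM C M → y ≠ inftyM C M → addM C x y ≠ inftyM C M
  | .smulFin c => ∀ x : M, x ≠ inftyM C M → smulM c x ≠ inftyM C M
  | .addInfty => ∀ x : M, addM C x (inftyM C M) = inftyM C M
  | .smulInfty c => smulM c (inftyM C M) = inftyM C M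
  | .valInfty => valM C (inftyM C M) = inftyM C M
  | .addComm => ∀ x y : M, addM C x y = addM C y x
  | .addAssoc => ∀ x y z : M, addM C (addM C x y) z = addM C x (addM C y z)
  | .zeroAdd => ∀ x : M, addM C (zeroM C M) x = x
  | .addNeg => ∀ x : M, x ≠ inftyM C M → addM C x (smulM (-1 : C) x) = zeroM C M
  | .smulAdd c => ∀ x y : M, smulM c (addM C x y) = addM C (smulM c x) (smulM c y)
  | .addSMul c d => ∀ x : M, smulM (c + d) x = addM C (smulM c x) (smulM d x)
  | .mulSMul c d => ∀ x : M, smulM (c * d) x = smulM c (smulM d x)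
  | .oneSMul => ∀ x : M, smulM (1 : C) x = x
  | .addLT i => ∀ x y z : M, x ≠ inftyM C M → y ≠ inftyM C M → z ≠ inftyM C M →
      ltM C i x y → ltM C i (addM C x z) (addM C y z)
  | .smulPos i c _ => ∀ x : M, x ≠ inftyM C M → ltM C i (zeroM C M) x →
      ltM C i (zeroM C M) (smulM c x)
  | .valZero => valM C (zeroM C M) = inftyM C M
  | .valFin => ∀ x : M, x ≠ inftyM C M → x ≠ zeroM C M → valM C x ≠ inftyM C M
  | .valAdd => ∀ x y : M, x ≠ inftyM C M → y ≠ inftyM C M →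
      (¬ ltM C 0 (valM C (addM C x y)) (valM C x) ∨ ¬ ltM C 0 (valM C (addM C x y)) (valM C y))
  | .valSMul c _ => ∀ x : M, x ≠ inftyM C M → valM C (smulM c x) = valM C x
  | .valConvex => ∀ x y : M, x ≠ inftyM C M → y ≠ inftyM C M → ltM C 1 (zeroM C M) x →
      ltM C 1 x y → ¬ ltM C 0 (valM C x) (valM C y)
  | .valIdem => ∀ x : M, x ≠ inftyM C M → valM C (valM C x) = valM C x
  | .valPos => ∀ x : M, x ≠ inftyM C M → ltM C 1 (zeroM C M) (valM C x)
  | .dense => ∀ x y : M, x ≠ inftyM C M → y ≠ inftyM C M → ltM C 0 x y →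
      ∃ z : M, z ≠ inftyM C M ∧ ltM C 0 x (valM C z) ∧ ltM C 0 (valM C z) y
  | .indep p q => ∀ a b c d : M, (p = true ∨ ltM C 0 a b) → (q = true ∨ ltM C 1 c d) →
      ∃ x : M, x ≠ inftyM C M ∧ ((p = true ∨ ltM C 0 a x) ∧ ltM C 0 x b) ∧
        ((q = true ∨ ltM C 1 c x) ∧ ltM C 1 x d)

open Ham in
theorem HamAxiom.realize_toSentence {C : Type u} [Field C] [LinearOrder C] (M : Type w)
    [(langHam C).Structure M] (a : HamAxiom C) : M ⊨ a.toSentence ↔ a.Holds M := by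
  cases a <;>
  simp [HamAxiom.toSentence, HamAxiom.Holds, Sentence.Realize, Formula.Realize, realize_zeroT,
    realize_inftyT, realize_addT, realize_smulT, realize_valT, realize_ltF, realize_finF,
    realize_lowF, Fin.snoc]

theorem THam_model_iff_holds {C : Type u} [Field C] [LinearOrder C] (M : Type w)
    [(langHam C).Structure M] : M ⊨ THam C ↔ ∀ a : HamAxiom C, a.Holds M := by
  simp [THam, Theory.model_iff, HamAxiom.realize_toSentence]

theorem topLT_coe {G : Type w} {r : G → G → Prop} {x y : G} : topLT r x y ↔ r x y := by
  let : LT G := ⟨r⟩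
  exact WithTop.coe_lt_coe

theorem topLT_top {G : Type w} {r : G → G → Prop} {x : G} : topLT r x ⊤ := by
  let : LT G := ⟨r⟩
  exact WithTop.coe_lt_top x

theorem not_top_topLT {G : Type w} {r : G → G → Prop} {x : WithTop G} : ¬ topLT r ⊤ x := by
  let : LT G := ⟨r⟩
  exact WithTop.not_top_lt (a := x)

theorem botTopLT_coe {G : Type w} {r : G → G → Prop} {x y : WithTop G} :
    botTopLT r (x : WithBot (WithTop G)) y ↔ topLT r x y := by
  let : LT G := ⟨r⟩
  exact WithBot.coe_lt_coe

theorem bot_botTopLT {G : Type w} {r : G → G → Prop} {x : WithTop G} :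
    botTopLT r ⊥ (x : WithBot (WithTop G)) := by
  let : LT G := ⟨r⟩
  exact WithBot.bot_lt_coe x

theorem not_botTopLT_bot {G : Type w} {r : G → G → Prop} {x : WithBot (WithTop G)} :
    ¬ botTopLT r x ⊥ := by
  let : LT G := ⟨r⟩
  exact WithBot.not_lt_bot x

section OfSpace

variable {C : Type u} [Field C] [LinearOrder C] [IsStrictOrderedRing C]
  {G : Type w} [AddCommGroup G] [Module C G]

open Ham in
theorem HamelSpace.holds (H : HamelSpace C G) (hi : H.IsIndependent) (hd : H.IsDense)
    (a : HamAxiom C) : letI := H.toStructure; a.Holds (WithTop G) := by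
  let := H.toStructure
  have hz : zeroM C (WithTop G) = ((0 : G) : WithTop G) := rfl
  have ht : inftyM C (WithTop G) = ⊤ := rfl
  have ha : ∀ x y : WithTop G, addM C x y = x + y := fun _ _ => rfl
  have hs : ∀ (c : C) (x : WithTop G), smulM c x = x.map (c • ·) := fun _ _ => rfl
  have hv : ∀ x : WithTop G, valM C x = x.recTopCoe ⊤ H.v := fun _ => rfl
  have hl : ∀ (i) (x y : WithTop G), ltM C i x y ↔ topLT (H.lt i) x y := fun _ _ _ => Iff.rfl
  have irr : ∀ i (x : WithTop G), ¬ topLT (H.lt i) x x := by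
    intro i x
    cases x
    · exact not_top_topLT
    · rw [topLT_coe]; exact H.lt_irrefl _ _
  have tr : ∀ i (x y z : WithTop G), topLT (H.lt i) x y → topLT (H.lt i) y z →
      topLT (H.lt i) x z := by
    intro i x y z
    cases x <;> cases y <;> cases z <;>
      simp only [topLT_coe, topLT_top, not_top_topLT, false_imp_iff, imp_true_iff, imp_self]
    exact H.lt_trans _ _ _ _
  have notlt : ∀ i (x y : WithTop G), topLE (H.lt i) x y → ¬ topLT (H.lt i) y x := by
    rintro i x y (h | rfl) h'
    · exact irr _ _ (tr _ _ _ _ h h')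
    · exact irr _ _ h'
  cases a <;> simp only [HamAxiom.Holds, hz, ht, ha, hs, hv, hl]
  case ltIrrefl i => exact irr i
  case ltTrans i => exact tr i
  case ltTotal i =>
    intro x y
    cases x <;> cases y <;> simp [topLT_coe, topLT_top, not_top_topLT, H.lt_total]
  case ltInfty i =>
    intro x hx
    cases x
    · exact absurd rfl hx
    · exact topLT_top
  case zeroFin => exact WithTop.coe_ne_top
  case addFin => intro x y hx hy; simp [hx, hy]
  case smulFin c => intro x hx; simpa using hx
  case addInfty => simp
  case smulInfty c => rfl
  case valInfty => rfl
  case addComm => exact add_comm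
  case addAssoc => exact add_assoc
  case zeroAdd => intro x; simp
  case addNeg =>
    intro x hx
    cases x
    · exact absurd rfl hx
    · rw [WithTop.map_coe, ← WithTop.coe_add]; simp
  case smulAdd c =>
    intro x y
    cases x <;> cases y <;> simp [← WithTop.coe_add]
  case addSMul c d =>
    intro x
    cases x <;> simp [← WithTop.coe_add, add_smul]
  case mulSMul c d =>
    intro x
    cases x <;> simp [mul_smul]
  case oneSMul =>
    intro x
    cases x <;> simp
  case addLT i =>
    intro x y z hx hy hz
    lift x to G using hx
    lift y to G using hy
    lift z to G using hz
    simp only [← WithTop.coe_add, topLT_coe]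
    exact H.add_lt_add _ _ _ _
  case smulPos i c hc =>
    intro x hx
    lift x to G using hx
    simp only [WithTop.map_coe, topLT_coe]
    exact H.smul_pos _ _ _ hc
  case valZero => exact (H.v_eq_top_iff 0).2 rfl
  case valFin =>
    intro x hx
    lift x to G using hx
    simp [H.v_eq_top_iff]
  case valAdd =>
    intro x y hx hy
    lift x to G using hx
    lift y to G using hy
    exact (H.v_add x y).imp (notlt _ _ _) (notlt _ _ _)
  case valSMul c hc =>
    intro x hx
    lift x to G using hx
    exact H.v_smul c x hc
  case valConvex =>
    intro x y hx hy
    lift x to G using hx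
    lift y to G using hy
    simp only [topLT_coe]
    exact fun h h' => notlt _ _ _ (H.v_convex x y h h')
  case valIdem =>
    intro x hx
    lift x to G using hx
    exact H.v_idem x
  case valPos =>
    intro x hx
    lift x to G using hx
    exact H.v_pos x
  case dense =>
    intro x y hx hy
    lift x to G using hx
    lift y to G using hy
    simp only [topLT_coe]
    intro h
    obtain ⟨c, hc⟩ := hd x y h
    exact ⟨c, WithTop.coe_ne_top, hc⟩
  case indep p q =>
    intro a b c d h h'
    have hi' := hi Finset.univ
      ![if p then ⊥ else (a : WithBot (WithTop G)), if q then ⊥ else (c : WithBot (WithTop G))]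
      ![(b : WithBot (WithTop G)), (d : WithBot (WithTop G))]
    simp only [Finset.mem_univ, true_imp_iff, Fin.forall_fin_two, Matrix.cons_val_zero,
      Matrix.cons_val_one] at hi'
    have key : ∀ (i) (p : Bool) (a b : WithTop G),
        botTopLT (H.lt i) (if p then ⊥ else (a : WithBot (WithTop G))) b ↔
          (p = true ∨ topLT (H.lt i) a b) := by
      intro i p a b
      cases p <;> simp [botTopLT_coe, bot_botTopLT]
    simp only [key, botTopLT_coe] at hi'
    obtain ⟨x, hx⟩ := hi' ⟨h, h'⟩
    exact ⟨x, WithTop.coe_ne_top, hx⟩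

end OfSpace

open Ham in
theorem THam_exists_space {C : Type u} [Field C] [LinearOrder C] [IsStrictOrderedRing C]
    (M : Type w) [(langHam C).Structure M] (hM : ∀ a : HamAxiom C, a.Holds M) :
    ∃ (G : Type w) (_ : AddCommGroup G) (_ : Module C G) (H : HamelSpace C G),
      H.IsIndependent ∧ H.IsDense ∧
        Nonempty (letI := H.toStructure; WithTop G ≃[langHam C] M) := by
  have addFin := hM .addFin
  have smulFin := fun c => hM (.smulFin c)
  have addComm := hM .addComm
  have addAssoc := hM .addAssoc
  have zeroAdd := hM .zeroAdd
  have addNeg := hM .addNeg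
  have addSMul := fun c d => hM (.addSMul c d)
  have zeroFin := hM .zeroFin
  have lirr := fun i => hM (.ltIrrefl i)
  have ltr := fun i => hM (.ltTrans i)
  have ltot := fun i => hM (.ltTotal i)
  have linf := fun i => hM (.ltInfty i)
  have addInfty := hM .addInfty
  simp only [HamAxiom.Holds] at addFin smulFin addComm addAssoc zeroAdd addNeg addSMul
  simp only [HamAxiom.Holds] at zeroFin lirr ltr ltot linf addInfty
  let G := {x : M // x ≠ inftyM C M}
  let z0 : G := ⟨zeroM C M, zeroFin⟩
  let a0 : G → G → G := fun x y => ⟨addM C x.1 y.1, addFin _ _ x.2 y.2⟩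
  let n0 : G → G := fun x => ⟨smulM (-1 : C) x.1, smulFin _ _ x.2⟩
  let iA : AddCommGroup G :=
    { zero := z0
      add := a0
      neg := n0
      nsmul := @nsmulRec G ⟨z0⟩ ⟨a0⟩
      zsmul := @zsmulRec G ⟨z0⟩ ⟨a0⟩ ⟨n0⟩ (@nsmulRec G ⟨z0⟩ ⟨a0⟩)
      add_assoc := fun x y z => Subtype.ext (addAssoc _ _ _)
      zero_add := fun x => Subtype.ext (zeroAdd _)
      add_zero := fun x => Subtype.ext ((addComm _ _).trans (zeroAdd _))
      neg_add_cancel := fun x => Subtype.ext ((addComm _ _).trans (addNeg _ x.2))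
      add_comm := fun x y => Subtype.ext (addComm _ _) }
  let smul' : C → G → G := fun c x => ⟨smulM c x.1, smulFin _ _ x.2⟩
  have smul_add' : ∀ c x y, smul' c (x + y) = smul' c x + smul' c y := fun c x y =>
    Subtype.ext (hM (.smulAdd c) _ _)
  have add_smul' : ∀ c d x, smul' (c + d) x = smul' c x + smul' d x :=
    fun c d x => Subtype.ext (addSMul _ _ _)
  let iM : Module C G :=
    { smul := smul'
      one_smul := fun x => Subtype.ext (hM .oneSMul x.1)
      mul_smul := fun c d x => Subtype.ext (hM (.mulSMul c d) x.1)
      smul_zero := fun c => by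
        have := smul_add' c 0 0
        rw [add_zero] at this
        exact left_eq_add.1 this
      smul_add := smul_add'
      add_smul := add_smul'
      zero_smul := fun x => by
        have := add_smul' 0 0 x
        rw [add_zero] at this
        exact left_eq_add.1 this }
  classical
  let toM : WithTop G → M := fun x => x.recTopCoe (inftyM C M) Subtype.val
  let ofM : M → WithTop G := fun x => if h : x = inftyM C M then ⊤ else ((⟨x, h⟩ : G) : WithTop G)
  have toM_ofM : ∀ x, toM (ofM x) = x := by
    intro x
    by_cases h : x = inftyM C M
    · simp [ofM, toM, h]
    · simp [ofM, toM, h]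
  have ofM_toM : ∀ x, ofM (toM x) = x := by
    intro x
    cases x with
    | top => simp [ofM, toM]
    | coe x => simp [ofM, toM, x.2]
  have toM_inj : Function.Injective toM := Function.LeftInverse.injective ofM_toM
  let lt : Fin 2 → G → G → Prop := fun i x y => ltM C i x.1 y.1
  have ninf : ∀ i (x : M), ¬ ltM C i (inftyM C M) x := by
    intro i x h
    by_cases hx : x = inftyM C M
    · rw [hx] at h; exact lirr _ _ h
    · exact lirr _ _ (ltr _ _ _ _ h (linf i x hx))
  have lt_iff : ∀ i (x y : WithTop G), topLT (lt i) x y ↔ ltM C i (toM x) (toM y) := by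
    intro i x y
    cases x with
    | top => exact iff_of_false not_top_topLT (ninf _ _)
    | coe x =>
      cases y with
      | top => exact iff_of_true topLT_top (linf i x.1 x.2)
      | coe y => exact topLT_coe
  have le_of : ∀ i (x y : WithTop G), ¬ ltM C i (toM y) (toM x) → topLE (lt i) x y := by
    intro i x y h
    rcases ltot i (toM x) (toM y) with h' | h' | h'
    · exact Or.inl ((lt_iff _ _ _).2 h')
    · exact Or.inr (toM_inj h')
    · exact absurd h' h
  let v : G → WithTop G := fun x => ofM (valM C x.1)
  have toM_v : ∀ x : G, toM (v x) = valM C x.1 := fun x => toM_ofM _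
  have toM_v' : ∀ x : WithTop G, toM (x.recTopCoe ⊤ v) = valM C (toM x) := by
    intro x
    cases x with
    | top => exact (hM .valInfty).symm
    | coe x => exact toM_v x
  let H : HamelSpace C G :=
    { lt := lt
      lt_irrefl := fun i x => lirr i x.1
      lt_trans := fun i x y z => ltr i x.1 y.1 z.1
      lt_total := fun i x y => by
        rcases ltot i x.1 y.1 with h | h | h
        · exact Or.inl h
        · exact Or.inr (Or.inl (Subtype.ext h))
        · exact Or.inr (Or.inr h)
      add_lt_add := fun i x y z => hM (.addLT i) _ _ _ x.2 y.2 z.2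
      smul_pos := fun i c x hc => hM (.smulPos i c hc) _ x.2
      v := v
      v_eq_top_iff := fun x => by
        rw [← toM_inj.eq_iff, toM_v]
        constructor
        · intro h
          by_contra h'
          exact hM .valFin x.1 x.2 (fun h'' => h' (Subtype.ext h'')) h
        · rintro rfl
          exact hM .valZero
      v_add := fun x y => by
        refine (hM .valAdd x.1 y.1 x.2 y.2).imp (fun h => le_of _ _ _ ?_) (fun h => le_of _ _ _ ?_)
        · rw [toM_v, toM_v]; exact h
        · rw [toM_v, toM_v]; exact h
      v_smul := fun c x hc => toM_inj (by
        rw [toM_v, toM_v]; exact hM (.valSMul c hc) x.1 x.2)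
      v_convex := fun x y h h' => le_of _ _ _ (by
        rw [toM_v, toM_v]; exact hM .valConvex x.1 y.1 x.2 y.2 h h')
      v_idem := fun x => toM_inj (by
        rw [toM_v', toM_v]; exact hM .valIdem x.1 x.2)
      v_pos := fun x => (lt_iff _ _ _).2 (by
        rw [toM_v]; exact hM .valPos x.1 x.2) }
  refine ⟨G, iA, iM, H, ?_, ?_, ?_⟩
  · intro S a b hab
    let a' : Fin 2 → WithBot (WithTop G) := fun i => if i ∈ S then a i else ⊥
    let b' : Fin 2 → WithBot (WithTop G) := fun i => if i ∈ S then b i else (⊤ : WithTop G)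
    have hab' : ∀ i, botTopLT (lt i) (a' i) (b' i) := by
      intro i
      by_cases hi : i ∈ S
      · simpa only [a', b', hi, if_true] using hab i hi
      · simp only [a', b', hi, if_false]; exact bot_botTopLT
    suffices h : ∃ x : G, ∀ i, botTopLT (lt i) (a' i) ((x : WithTop G) : WithBot (WithTop G)) ∧
        botTopLT (lt i) ((x : WithTop G) : WithBot (WithTop G)) (b' i) by
      obtain ⟨x, hx⟩ := h
      refine ⟨x, fun i hi => ?_⟩
      simpa only [a', b', hi, if_true] using hx i
    have key : ∀ i, ∃ (p : Bool) (c d : M), (p = true ∨ ltM C i c d) ∧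
        ∀ x : G, (p = true ∨ ltM C i c x.1) ∧ ltM C i x.1 d →
          botTopLT (lt i) (a' i) ((x : WithTop G) : WithBot (WithTop G)) ∧
          botTopLT (lt i) ((x : WithTop G) : WithBot (WithTop G)) (b' i) := by
      intro i
      have h := hab' i
      generalize a' i = s at h ⊢
      generalize b' i = t at h ⊢
      induction t using WithBot.recBotCoe with
      | bot => exact absurd h not_botTopLT_bot
      | coe t =>
        induction s using WithBot.recBotCoe with
        | bot =>
          refine ⟨true, toM t, toM t, Or.inl rfl, fun x hx => ⟨bot_botTopLT, ?_⟩⟩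
          rw [botTopLT_coe, lt_iff]
          exact hx.2
        | coe s =>
          rw [botTopLT_coe, lt_iff] at h
          refine ⟨false, toM s, toM t, Or.inr h, fun x hx => ?_⟩
          rw [botTopLT_coe, botTopLT_coe, lt_iff, lt_iff]
          exact ⟨hx.1.resolve_left (by simp), hx.2⟩
    obtain ⟨p, c, d, h0, k0⟩ := key 0
    obtain ⟨q, e, f, h1, k1⟩ := key 1
    obtain ⟨x, hx, hx0, hx1⟩ := hM (.indep p q) c d e f h0 h1
    refine ⟨⟨x, hx⟩, ?_⟩
    rw [Fin.forall_fin_two]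
    exact ⟨k0 _ hx0, k1 _ hx1⟩
  · intro a b hab
    obtain ⟨z, hz, h1, h2⟩ := hM .dense a.1 b.1 a.2 b.2 hab
    refine ⟨⟨z, hz⟩, (lt_iff _ _ _).2 ?_, (lt_iff _ _ _).2 ?_⟩
    · exact (toM_v ⟨z, hz⟩).symm ▸ h1
    · exact (toM_v ⟨z, hz⟩).symm ▸ h2
  · let := H.toStructure
    have e2 : ∀ (g : Fin 1 → WithTop G), toM ∘ g = ![toM (g 0)] := fun g => by
      funext i; fin_cases i; rfl
    have e3 : ∀ (g : Fin 2 → WithTop G), toM ∘ g = ![toM (g 0), toM (g 1)] := fun g => by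
      funext i; fin_cases i <;> rfl
    refine ⟨{ toFun := toM, invFun := ofM, left_inv := ofM_toM, right_inv := toM_ofM,
              map_fun' := ?_, map_rel' := ?_ }⟩
    · intro k f x
      cases f with
      | zero =>
        rw [Subsingleton.elim (toM ∘ x) (![] : Fin 0 → M)]; rfl
      | infty =>
        rw [Subsingleton.elim (toM ∘ x) (![] : Fin 0 → M)]; rfl
      | add =>
        rw [e3]
        change toM (x 0 + x 1) = addM C (toM (x 0)) (toM (x 1))
        generalize x 0 = s
        generalize x 1 = t
        cases s with
        | top => rw [addComm]; exact (addInfty _).symm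
        | coe s =>
          cases t with
          | top => exact (addInfty _).symm
          | coe t => rfl
      | smul c =>
        rw [e2]
        change toM ((x 0).map (c • ·)) = smulM c (toM (x 0))
        generalize x 0 = s
        cases s with
        | top => exact (hM (.smulInfty c)).symm
        | coe s => rfl
      | val =>
        rw [e2]
        exact toM_v' (x 0)
    · intro k r x
      cases r with
      | lt i =>
        rw [e3]
        exact (lt_iff i (x 0) (x 1)).symm

/-- The models of `THam C` are, up to isomorphism, exactly the independent and dense Hamel spaces
over `C`. -/
theorem THam_models_iff {C : Type u} [Field C] [LinearOrder C] [IsStrictOrderedRing C]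
    (M : Type w) [(langHam C).Structure M] :
    M ⊨ THam C ↔ ∃ (G : Type w) (_ : AddCommGroup G) (_ : Module C G) (H : HamelSpace C G),
      H.IsIndependent ∧ H.IsDense ∧
        Nonempty (letI := H.toStructure; WithTop G ≃[langHam C] M) := by
  constructor
  · exact fun h => THam_exists_space M ((THam_model_iff_holds M).1 h)
  · rintro ⟨G, _, _, H, hi, hd, ⟨e⟩⟩
    let := H.toStructure
    have : WithTop G ⊨ THam C := (THam_model_iff_holds _).2 (H.holds hi hd)
    exact (StrongHomClass.theory_model e : M ⊨ THam C)

end Models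

/-! The independence property already fails for one sequence of tuples `a i` and one infinite,
co-infinite set taken along a suitable subsequence. Two ingredients carry this.

The first is that, over countably many scalars, the sequence has a subsequence along which every
atomic formula, with arbitrary parameters, is eventually constant in truth value
(`exists_decidedAlong`). There are uncountably many parameters, so no diagonal argument over them is
possible. Instead, by induction on terms, the sequences `t(a n, b)` are eventually translates `s n +
w` with `s` from a countable set independent of `b` (`exists_isControlled_term`). The valuation is
the only hard case: `v (a n + w)` is eventually constant or eventually equal to a sequence that does
not involve `w` (`exists_v_add_eq`). An inequality between translates compares one sequence with a
threshold, and a strictly monotone or constant subsequence settles all thresholds at once.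

The second is that, in a countably saturated, independent and dense Hamel space, quantifier-free
types of countable tuples determine types (`realize_iff_of_quantifierFree`). This is a
back-and-forth between countable partial isomorphisms. A missing value is adjoined by density, since
its cut in `lt 0` determines everything else about it. Once all values `v (x - p)` lie in the
domain, `x` is adjoined: its cut in `lt 1` and these values can be matched, finitely many at a time,
on a whole interval (`exists_interval`), and independence intersects that interval with one for `lt
0`.

Let `J` consist of every second term of the subsequence. In an ultrapower, the class of the terms in
`J` and the class of the others have the same quantifier-free type together with `b J`, hence the
same type, although `φ` separates them. A formula uses only countably many scalars, which reduces
the general case to a countable field. -/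

/-! ### Convex valuations on ordered vector spaces -/

section ConvexValuation

/-- A convex valuation on an ordered vector space, with values in a linearly ordered set. -/
structure IsConvexValuation (K : Type*) [Field K] {G Γ : Type*} [AddCommGroup G] [Module K G]
    [LinearOrder G] [LinearOrder Γ] (v : G → Γ) : Prop where
  add : ∀ x y, min (v x) (v y) ≤ v (x + y)
  smul : ∀ (c : K) x, c ≠ 0 → v (c • x) = v x
  convex : ∀ x y, 0 < x → x ≤ y → v y ≤ v x

namespace IsConvexValuation

variable {K : Type*} [Field K] {G Γ : Type*} [AddCommGroup G] [Module K G]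
  [LinearOrder G] [LinearOrder Γ] {v : G → Γ} (hv : IsConvexValuation K v)

include hv

theorem neg (x : G) : v (-x) = v x := by
  rw [← neg_one_smul K x]
  exact hv.smul _ _ (by simp)

theorem sub_comm (x y : G) : v (x - y) = v (y - x) := by
  rw [← hv.neg, neg_sub]

theorem le_zero (x : G) : v x ≤ v 0 := by
  have := hv.add x (-x)
  rwa [hv.neg, min_self, add_neg_cancel] at this

theorem sub (x y : G) : min (v x) (v y) ≤ v (x - y) := by
  have := hv.add x (-y)
  rwa [hv.neg, ← sub_eq_add_neg] at this

theorem add_eq_left {x y : G} (h : v x < v y) : v (x + y) = v x := by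
  apply le_antisymm
  · have := hv.sub (x + y) y
    rw [add_sub_cancel_right] at this
    rcases min_le_iff.1 this with h' | h'
    · exact h'
    · exact absurd h (not_lt.2 h')
  · simpa [h.le] using hv.add x y

theorem add_eq_min {x y : G} (h : v x ≠ v y) : v (x + y) = min (v x) (v y) := by
  rcases lt_or_gt_of_ne h with h | h
  · rw [hv.add_eq_left h, min_eq_left h.le]
  · rw [add_comm, hv.add_eq_left h, min_eq_right h.le]

theorem sub_eq_min {x y : G} (h : v x ≠ v y) : v (x - y) = min (v x) (v y) := by
  rw [sub_eq_add_neg, hv.add_eq_min (by rwa [hv.neg]), hv.neg]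

theorem convex' {x y : G} (hx : 0 ≤ x) (h : x ≤ y) : v y ≤ v x := by
  rcases hx.eq_or_lt with rfl | hx
  · exact hv.le_zero y
  · exact hv.convex x y hx h

variable [IsOrderedAddMonoid G]

/-- Summands of the same sign cannot cancel: the sum dominates both, so convexity bounds its value
by each of theirs. -/
theorem add_of_nonneg {x y : G} (hx : 0 ≤ x) (hy : 0 ≤ y) : v (x + y) = min (v x) (v y) :=
  le_antisymm (le_min (hv.convex' hx (by simpa)) (hv.convex' hy (by simpa))) (hv.add x y)

variable {P : Submodule K (G × G)} {R : Γ → Γ → Prop}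
  (hpos : ∀ p ∈ P, 0 < p.1 ↔ 0 < p.2)
  (hR : ∀ a b c d, R a b → R c d → (a < c ↔ b < d))
  (hP : ∀ p ∈ P, R (v p.1) (v p.2)) [CharZero K]

include hpos hR hP

/-- The point `p` of `F` nearest to `x` controls all others. Moving from `p.2` by an amount
comparable to a small positive `δ` of the same value as `x - p.1` reproduces the position and the
distances of `x`, and an open interval of such amounts works. -/
theorem exists_interval_of_lt {F : Finset (G × G)} (hF : ∀ p ∈ F, p ∈ P) {x : G} {p : G × G}
    (hp : p ∈ F) (hmin : ∀ a ∈ F, |x - p.1| ≤ |x - a.1|) (hpx : p.1 < x)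
    (hg : ∃ g ∈ P, 0 < g.1 ∧ v g.1 = v (x - p.1)) :
    ∃ d₁ d₂, d₁ < d₂ ∧ ∀ y, d₁ < y → y < d₂ → ∀ a ∈ F, (a.1 < x → a.2 < y) ∧
      (x < a.1 → y < a.2) ∧ R (v (x - a.1)) (v (y - a.2)) := by
  classical
  obtain ⟨g, hgP, hg0, hgv⟩ := hg
  have hle : ∀ p ∈ P, 0 ≤ p.1 ↔ 0 ≤ p.2 := by
    intro q hq
    have := hpos (-q) (P.neg_mem hq)
    simp only [Prod.fst_neg, Prod.snd_neg, Left.neg_pos_iff] at this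
    rw [← not_lt, ← not_lt, this]
  have hRmin : ∀ a b c d, R a b → R c d → R (min a c) (min b d) := by
    intro a b c d h h'
    rcases lt_or_ge a c with h1 | h1
    · rw [min_eq_left h1.le, min_eq_left ((hR _ _ _ _ h h').1 h1).le]; exact h
    · have := (not_congr (hR _ _ _ _ h h')).1 (not_lt.2 h1)
      rw [min_eq_right h1, min_eq_right (not_lt.1 this)]; exact h'
  -- The factor 3 leaves room: a `y` below `p.2 + 2δ.2` still has distance at least `δ.2` from every
  -- point of `F` above `p` at the critical value. The witness is the least of `g` and the elements
  -- `(a - p) / 3`.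
  obtain ⟨δ, hδP, hδ0, hδv, hδ⟩ : ∃ δ ∈ P, 0 < δ.1 ∧ v δ.1 = v (x - p.1) ∧
      ∀ a ∈ F, p.1 < a.1 → v (a.1 - p.1) = v (x - p.1) → 3 • δ.1 ≤ a.1 - p.1 := by
    let s : Finset (G × G) := insert g
      ((F.filter fun a => p.1 < a.1 ∧ v (a.1 - p.1) = v (x - p.1)).image
        fun a => (3 : K)⁻¹ • (a - p))
    have h3 : ∀ z : G, 3 • ((3 : K)⁻¹ • z) = z := by
      intro z
      rw [← Nat.cast_smul_eq_nsmul K, smul_smul]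
      simp
    obtain ⟨δ, hδs, hδ⟩ := s.exists_min_image Prod.fst ⟨g, by simp [s]⟩
    have key : ∀ δ ∈ s, δ ∈ P ∧ 0 < δ.1 ∧ v δ.1 = v (x - p.1) := by
      intro δ hδ
      simp only [s, Finset.mem_insert, Finset.mem_image, Finset.mem_filter] at hδ
      rcases hδ with rfl | ⟨a, ⟨ha, hpa, hav⟩, rfl⟩
      · exact ⟨hgP, hg0, hgv⟩
      · refine ⟨P.smul_mem _ (P.sub_mem (hF _ ha) (hF _ hp)), ?_, ?_⟩
        · by_contra hcon
          have := nsmul_nonpos (not_lt.1 hcon) 3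
          rw [Prod.smul_fst, h3] at this
          exact absurd (sub_pos.2 hpa) (not_lt.2 this)
        · rw [Prod.smul_fst, hv.smul _ _ (by simp)]
          exact hav
    refine ⟨δ, (key δ hδs).1, (key δ hδs).2.1, (key δ hδs).2.2, fun a ha hpa hav => ?_⟩
    have := hδ ((3 : K)⁻¹ • (a - p)) (by
      simp only [s, Finset.mem_insert, Finset.mem_image, Finset.mem_filter]
      exact Or.inr ⟨a, ⟨ha, hpa, hav⟩, rfl⟩)
    calc 3 • δ.1 ≤ 3 • ((3 : K)⁻¹ • (a - p)).1 := nsmul_le_nsmul_right this 3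
      _ = a.1 - p.1 := by rw [Prod.smul_fst, h3]; rfl
  have hδ2 : 0 < δ.2 := (hpos δ hδP).1 hδ0
  have hRδ : R (v (x - p.1)) (v δ.2) := hδv ▸ hP δ hδP
  refine ⟨p.2 + δ.2, p.2 + 2 • δ.2, by grind, fun y hy1 hy2 a ha => ?_⟩
  have hz : v (y - p.2) = v δ.2 := by
    apply le_antisymm
    · exact hv.convex _ _ hδ2 (by grind)
    · rw [← hv.smul (2 : K) δ.2 (by simp)]
      refine hv.convex _ _ (by grind) ?_
      rw [ofNat_smul_eq_nsmul]
      grind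
  have hRa : R (v (a.1 - p.1)) (v (a.2 - p.2)) := hP _ (P.sub_mem (hF _ ha) (hF _ hp))
  have hapos : 0 < a.1 - p.1 ↔ 0 < a.2 - p.2 := hpos _ (P.sub_mem (hF _ ha) (hF _ hp))
  rcases le_or_gt a.1 p.1 with hap | hap
  -- On this side the path from `a` to `x` passes through `p`, so the values of the two pieces
  -- combine by `min`.
  · have hap2 : a.2 ≤ p.2 := by
      by_contra hcon
      exact absurd (hapos.2 (sub_pos.2 (not_le.1 hcon))) (by simpa using hap)
    refine ⟨fun _ => by grind, fun h => absurd (h.trans_le hap) hpx.not_gt, ?_⟩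
    have e1 : x - a.1 = (p.1 - a.1) + (x - p.1) := by abel
    have e2 : y - a.2 = (p.2 - a.2) + (y - p.2) := by abel
    rw [e1, e2, hv.add_of_nonneg (by simpa) (by simpa using hpx.le),
      hv.add_of_nonneg (by simpa) (by grind), hz, hv.sub_comm p.1, hv.sub_comm p.2]
    exact hRmin _ _ _ _ hRa hRδ
  · have h := hmin a ha
    rw [abs_of_pos (sub_pos.2 hpx)] at h
    have hxa : x < a.1 := by
      by_contra hcon
      rw [abs_of_nonneg (by simpa using hcon)] at h
      grind
    -- As `p` is at least as near to `x` as `a` is, `a - x` is the dominant piece of `a - p`.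
    have hvax : v (a.1 - p.1) = v (x - a.1) := by
      rw [abs_sub_comm, abs_of_pos (sub_pos.2 hxa)] at h
      have e1 : a.1 - p.1 = (a.1 - x) + (x - p.1) := by abel
      rw [e1, hv.add_of_nonneg (by simpa using hxa.le) (by simpa using hpx.le), hv.sub_comm x a.1]
      exact min_eq_left (hv.convex _ _ (by simpa) h)
    have hap2 := hapos.1 (sub_pos.2 hap)
    -- Either `a` is far from `p` on the scale of `x - p`, and the displacement is negligible, or it
    -- is on the same scale, and the choice of `δ` applies.
    rcases lt_or_ge (v (a.1 - p.1)) (v (x - p.1)) with hlt | hge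
    · have hlt2 := (hR _ _ _ _ hRa hRδ).1 hlt
      have hya : y < a.2 := by
        by_contra hcon
        have := hv.convex _ (y - p.2) hap2 (by grind)
        exact absurd hlt2 (not_lt.2 (hz ▸ this))
      refine ⟨fun h => absurd h hxa.not_gt, fun _ => hya, ?_⟩
      rw [← hvax]
      have e2 : y - a.2 = (y - p.2) - (a.2 - p.2) := by abel
      rw [e2, hv.sub_eq_min (x := y - p.2) (y := a.2 - p.2) (by rw [hz]; exact hlt2.ne'), hz,
        min_eq_right hlt2.le]
      exact hRa
    · have heq : v (a.1 - p.1) = v (x - p.1) :=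
        le_antisymm (hv.convex _ _ (by simpa using hpx) (by grind)) hge
      have h3 := hδ a ha hap heq
      have h3' : 3 • δ.2 ≤ a.2 - p.2 := by
        have := (hle ((a - p) - 3 • δ)
          (P.sub_mem (P.sub_mem (hF _ ha) (hF _ hp)) (P.nsmul_mem hδP 3))).1
          (by simpa using h3)
        simpa using this
      have hya : δ.2 ≤ a.2 - y := by grind
      refine ⟨fun h => absurd h hxa.not_gt, fun _ => by grind, ?_⟩
      rw [← hvax, hv.sub_comm y]
      have e2 : a.2 - p.2 = (a.2 - y) + (y - p.2) := by abel
      rw [e2, hv.add_of_nonneg (by grind) (by grind), hz,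
        min_eq_left (hv.convex _ _ hδ2 hya)] at hRa
      exact hRa

/-- The nearest point may also lie above `x`; the reflection `z ↦ -z` reduces that case to the
previous one. -/
theorem exists_interval {F : Finset (G × G)} (hF : ∀ p ∈ F, p ∈ P) (hne : F.Nonempty) {x : G}
    (hx : ∀ p ∈ F, p.1 ≠ x)
    (hg : ∀ p ∈ F, ∃ g ∈ P, 0 < g.1 ∧ v g.1 = v (x - p.1)) :
    ∃ d₁ d₂, d₁ < d₂ ∧ ∀ y, d₁ < y → y < d₂ → ∀ a ∈ F, (a.1 < x → a.2 < y) ∧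
      (x < a.1 → y < a.2) ∧ R (v (x - a.1)) (v (y - a.2)) := by
  classical
  obtain ⟨p, hp, hmin⟩ := F.exists_min_image (fun a => |x - a.1|) hne
  rcases lt_or_gt_of_ne (hx p hp) with h | h
  · exact hv.exists_interval_of_lt hpos hR hP hF hp hmin h (hg p hp)
  · have hmem : ∀ a ∈ F, -a ∈ F.image Neg.neg := fun a ha => Finset.mem_image_of_mem _ ha
    obtain ⟨d₁, d₂, hd, H⟩ := hv.exists_interval_of_lt hpos hR hP
      (F := F.image Neg.neg) (x := -x) (p := -p)
      (Finset.forall_mem_image.2 fun a ha => P.neg_mem (hF a ha)) (hmem p hp)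
      (by
        simp only [Finset.forall_mem_image, Prod.fst_neg, ← neg_sub', abs_neg]
        exact hmin)
      (by simpa using h)
      (by
        obtain ⟨g, hg1, hg2, hg3⟩ := hg p hp
        refine ⟨g, hg1, hg2, ?_⟩
        rw [hg3, Prod.fst_neg, ← neg_sub', hv.neg])
    refine ⟨-d₂, -d₁, by simpa using hd, fun y h1 h2 a ha => ?_⟩
    obtain ⟨k1, k2, k3⟩ := H (-y) (lt_neg.1 h2) (neg_lt.1 h1) _ (hmem a ha)
    simp only [Prod.fst_neg, Prod.snd_neg, neg_lt_neg_iff, ← neg_sub', hv.neg] at k1 k2 k3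
    exact ⟨k2, k1, k3⟩

end IsConvexValuation

end ConvexValuation

/-- No density is needed, since the endpoints may be the largest lower and the smallest upper bound;
the absence of endpoints covers an empty side. -/
theorem exists_lt_between_finsets {X : Type*} [LinearOrder X] [NoMinOrder X] [NoMaxOrder X]
    [Nonempty X] (L U : Finset X) (h : ∀ l ∈ L, ∀ u ∈ U, l < u) :
    ∃ a b, a < b ∧ (∀ l ∈ L, l ≤ a) ∧ ∀ u ∈ U, b ≤ u := by
  rcases L.eq_empty_or_nonempty with rfl | hL
  · obtain ⟨b, hb⟩ : ∃ b, ∀ u ∈ U, b ≤ u := by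
      rcases U.eq_empty_or_nonempty with rfl | hU
      · exact ⟨Classical.arbitrary X, by simp⟩
      · exact ⟨U.min' hU, fun u hu => U.min'_le u hu⟩
    obtain ⟨a, ha⟩ := exists_lt b
    exact ⟨a, b, ha, by simp, hb⟩
  · have hm := L.max'_mem hL
    rcases U.eq_empty_or_nonempty with rfl | hU
    · obtain ⟨b, hb⟩ := exists_gt (L.max' hL)
      exact ⟨_, b, hb, fun l hl => L.le_max' l hl, by simp⟩
    · exact ⟨_, _, h _ hm _ (U.min'_mem hU), fun l hl => L.le_max' l hl,
        fun u hu => U.min'_le u hu⟩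

/-! ### The two orderings and the valuation of a Hamel space -/

namespace HamelSpace

section RelTop

variable {K : Type*} [Field K] {G : Type*} [AddCommGroup G] [Module K G]

/-- The relation on `G ∪ {∞}` obtained from a relation on `G` by relating `∞` to itself. -/
def RelTop (P : Submodule K (G × G)) (s t : WithTop G) : Prop :=
  (s = ⊤ ∧ t = ⊤) ∨ ∃ p ∈ P, s = p.1 ∧ t = p.2

theorem RelTop.mono {P Q : Submodule K (G × G)} (h : P ≤ Q) {s t : WithTop G} :
    RelTop P s t → RelTop Q s t :=
  Or.imp id fun ⟨p, hp, hs⟩ => ⟨p, h hp, hs⟩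

theorem relTop_coe {P : Submodule K (G × G)} {x y : G} :
    RelTop P (x : WithTop G) y ↔ (x, y) ∈ P := by
  constructor
  · rintro (⟨h, -⟩ | ⟨⟨p, q⟩, hp, h1, h2⟩)
    · exact absurd h WithTop.coe_ne_top
    · rw [WithTop.coe_inj] at h1 h2
      subst h1 h2
      exact hp
  · exact fun h => Or.inr ⟨_, h, rfl, rfl⟩

theorem RelTop.sumElim {P : Submodule K (G × G)} {α β : Type*} {e e' : α → WithTop G}
    {f f' : β → WithTop G} (h : ∀ a, RelTop P (e a) (e' a)) (h' : ∀ b, RelTop P (f b) (f' b)) :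
    ∀ c, RelTop P (Sum.elim e f c) (Sum.elim e' f' c) :=
  Sum.rec h h'

theorem RelTop.snoc {P : Submodule K (G × G)} {n : ℕ} {xs xs' : Fin n → WithTop G}
    (h : ∀ i, RelTop P (xs i) (xs' i)) {x x' : WithTop G} (hx : RelTop P x x') :
    ∀ i, RelTop P (Fin.snoc (α := fun _ => WithTop G) xs x i)
      (Fin.snoc (α := fun _ => WithTop G) xs' x' i) := by
  intro i
  induction i using Fin.lastCases with
  | last => simpa using hx
  | cast i => simpa using h i

end RelTop

variable {K : Type u} [Field K] [LinearOrder K] [IsStrictOrderedRing K]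
  {G : Type w} [AddCommGroup G] [Module K G] (H : HamelSpace K G)

section Orders

theorem lt_iff_sub (i : Fin 2) (x y : G) : H.lt i x y ↔ H.lt i 0 (y - x) := by
  constructor
  · intro h
    simpa [sub_eq_add_neg] using H.add_lt_add i x y (-x) h
  · intro h
    simpa using H.add_lt_add i 0 (y - x) x h

theorem lt_asymm {i : Fin 2} {x y : G} (h : H.lt i x y) : ¬ H.lt i y x :=
  fun h' => H.lt_irrefl i x (H.lt_trans i _ _ _ h h')

theorem not_lt_and_ne {i : Fin 2} {x y : G} (h : x ≠ y) : ¬ H.lt i x y ↔ H.lt i y x := by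
  constructor
  · exact fun h' => ((H.lt_total i x y).resolve_left h').resolve_left h
  · exact H.lt_asymm

theorem gt_iff_of_lt_iff {S : Type*} [SetLike S (G × G)] {P : S} (i : Fin 2) {x x' : G}
    (hx : ∀ p ∈ P, p.1 ≠ x) (hx' : ∀ p ∈ P, p.2 ≠ x')
    (hlt : ∀ p ∈ P, H.lt i p.1 x ↔ H.lt i p.2 x') :
    ∀ p ∈ P, H.lt i x p.1 ↔ H.lt i x' p.2 := by
  intro p hp
  rw [← H.not_lt_and_ne (hx p hp), ← H.not_lt_and_ne (hx' p hp), hlt p hp]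

/-- The linear order `lt i` of a Hamel space. -/
@[reducible]
noncomputable def linOrd (i : Fin 2) : LinearOrder G where
  le x y := H.lt i x y ∨ x = y
  lt := H.lt i
  le_refl x := Or.inr rfl
  le_trans := by
    rintro x y z (h | rfl) (h' | rfl)
    · exact Or.inl (H.lt_trans i _ _ _ h h')
    · exact Or.inl h
    · exact Or.inl h'
    · exact Or.inr rfl
  le_antisymm := by
    rintro x y (h | h) (h' | h')
    · exact absurd h' (H.lt_asymm h)
    · exact h'.symm
    · exact h
    · exact h
  lt_iff_le_not_ge x y := by
    constructor
    · rintro h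
      refine ⟨Or.inl h, ?_⟩
      rintro (h' | rfl)
      · exact H.lt_asymm h h'
      · exact H.lt_irrefl i _ h
    · rintro ⟨h | rfl, h'⟩
      · exact h
      · exact absurd (Or.inr rfl) h'
  le_total x y := by
    rcases H.lt_total i x y with h | h | h
    · exact Or.inl (Or.inl h)
    · exact Or.inl (Or.inr h)
    · exact Or.inr (Or.inl h)
  toDecidableLE := Classical.decRel _

theorem isOrderedAddMonoid (i : Fin 2) : @IsOrderedAddMonoid G _ (H.linOrd i).toPreorder :=
  letI := H.linOrd i
  { add_le_add_left := by
      rintro x y (h | rfl) z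
      · exact Or.inl (H.add_lt_add i _ _ z h)
      · exact Or.inr rfl }

/-- The ordering of the values of a Hamel space. -/
@[reducible]
noncomputable def valOrd : LinearOrder (WithTop G) :=
  letI := H.linOrd 0
  inferInstance

/-- The ordered set of values of a Hamel space. -/
def ValueSet (_ : HamelSpace K G) : Type w := WithTop G

noncomputable instance : LinearOrder H.ValueSet := H.valOrd

/-- Convexity refers to `lt 1` on `G`, whereas values are compared by `lt 0`; the synonym `ValueSet`
keeps the two order instances apart. -/
theorem isConvexValuation :
    letI := H.linOrd 1
    IsConvexValuation K (Γ := H.ValueSet) H.v := by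
  let := H.linOrd 1
  have le : ∀ s t : H.ValueSet, topLE (H.lt 0) s t → s ≤ t := by
    rintro s t (h | rfl)
    · exact le_of_lt (α := H.ValueSet) h
    · exact le_rfl
  refine ⟨fun x y => ?_, H.v_smul, ?_⟩
  · rcases H.v_add x y with h | h
    · exact (min_le_left _ _).trans (le _ _ h)
    · exact (min_le_right _ _).trans (le _ _ h)
  · rintro x y hx (h | rfl)
    · exact le _ _ (H.v_convex x y hx h)
    · exact le_rfl

theorem topLT_asymm {s t : WithTop G} (h : topLT (H.lt 0) s t) : ¬ topLT (H.lt 0) t s :=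
  _root_.lt_asymm (α := H.ValueSet) h

theorem topLT_total {s t : WithTop G} (h : s ≠ t) : topLT (H.lt 0) s t ∨ topLT (H.lt 0) t s :=
  lt_or_gt_of_ne (α := H.ValueSet) h

theorem v_sub_comm (x y : G) : H.v (x - y) = H.v (y - x) :=
  let := H.linOrd 1
  H.isConvexValuation.sub_comm x y

theorem v_add_of_lt {x y : G} (h : topLT (H.lt 0) (H.v x) (H.v y)) : H.v (x + y) = H.v x :=
  let := H.linOrd 1
  H.isConvexValuation.add_eq_left h

theorem v_sub_of_lt {x y : G} (h : topLT (H.lt 0) (H.v x) (H.v y)) : H.v (x - y) = H.v x := by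
  let := H.linOrd 1
  rw [sub_eq_add_neg]
  exact H.v_add_of_lt ((H.isConvexValuation.neg y).symm ▸ h)

theorem exists_v_eq_coe {x : G} (hx : x ≠ 0) : ∃ g : G, H.v x = g :=
  ⟨_, (WithTop.coe_untop _ (mt (H.v_eq_top_iff x).1 hx)).symm⟩

theorem v_eq_self {x g : G} (h : H.v x = g) : H.v g = g := by
  have := H.v_idem x
  rwa [h] at this

theorem pos_of_v_eq {x g : G} (h : H.v x = g) : H.lt 1 0 g := by
  have := H.v_pos x
  rwa [h, topLT_coe] at this

/-- The ordering `lt 1` of `G` relative to a value is determined by `v` and the ordering `lt 0`. -/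
theorem lt_one_value_iff {a g : G} (hg : H.v g = g) (hag : H.v a ≠ g) :
    H.lt 1 a g ↔ ¬ H.lt 1 0 a ∨ topLT (H.lt 0) (g : WithTop G) (H.v a) := by
  have hg0 : H.lt 1 0 g := H.pos_of_v_eq hg
  constructor
  · intro h
    rw [or_iff_not_imp_left, not_not]
    intro ha
    have := H.v_convex a g ha h
    rw [hg] at this
    exact this.resolve_right hag.symm
  · rintro (h | h)
    · by_cases h0 : a = 0
      · rwa [h0]
      · exact H.lt_trans 1 _ _ _ ((H.not_lt_and_ne (Ne.symm h0)).1 h) hg0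
    · have hne : g ≠ a := by
        rintro rfl
        exact hag hg
      rw [← H.not_lt_and_ne hne]
      intro hcon
      have := H.v_convex g a hg0 hcon
      rw [hg] at this
      exact H.topLT_asymm h (this.resolve_right hag)

end Orders

section Independent

variable {H}

theorem IsIndependent.exists_between (hi : H.IsIndependent) {a b c d : G} (h : H.lt 0 a b)
    (h' : H.lt 1 c d) : ∃ x, H.lt 0 a x ∧ H.lt 0 x b ∧ H.lt 1 c x ∧ H.lt 1 x d := by
  obtain ⟨x, hx⟩ := hi Finset.univ ![((a : WithTop G) : WithBot (WithTop G)), (c : WithTop G)]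
    ![((b : WithTop G) : WithBot (WithTop G)), (d : WithTop G)]
    (by simp [Fin.forall_fin_two, botTopLT_coe, topLT_coe, h, h'])
  simp [Fin.forall_fin_two, botTopLT_coe, topLT_coe] at hx
  exact ⟨x, hx.1.1, hx.1.2, hx.2.1, hx.2.2⟩

theorem IsIndependent.exists_pos (hi : H.IsIndependent) (i : Fin 2) : ∃ x, H.lt i 0 x := by
  obtain ⟨x, hx⟩ := hi {i} (fun _ => ((0 : G) : WithTop G)) (fun _ => (⊤ : WithTop G))
    (fun _ _ => botTopLT_coe.2 topLT_top)
  exact ⟨x, topLT_coe.1 (botTopLT_coe.1 (hx i (Finset.mem_singleton_self i)).1)⟩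

theorem IsIndependent.noMaxOrder (hi : H.IsIndependent) (i : Fin 2) :
    @NoMaxOrder G (H.linOrd i).toLT := by
  let := H.linOrd i
  obtain ⟨g, hg⟩ := hi.exists_pos i
  refine ⟨fun x => ⟨x + g, ?_⟩⟩
  have := H.add_lt_add i 0 g x hg
  rwa [zero_add, add_comm] at this

theorem IsIndependent.noMinOrder (hi : H.IsIndependent) (i : Fin 2) :
    @NoMinOrder G (H.linOrd i).toLT := by
  let := H.linOrd i
  obtain ⟨g, hg⟩ := hi.exists_pos i
  refine ⟨fun x => ⟨x - g, ?_⟩⟩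
  have := H.add_lt_add i 0 g (x - g) hg
  rwa [zero_add, add_sub_cancel] at this

end Independent

/-! ### Partial isomorphisms and their extension by one element -/

section PartialIso

/-- The graph `P` of an isomorphism between subspaces of a Hamel space that are closed under the
Hamel valuation. -/
structure IsPartialIso (P : Submodule K (G × G)) : Prop where
  pos : ∀ i, ∀ p ∈ P, H.lt i 0 p.1 ↔ H.lt i 0 p.2
  val : ∀ p ∈ P, RelTop P (H.v p.1) (H.v p.2)

namespace IsPartialIso

variable {H} {P : Submodule K (G × G)} (hP : H.IsPartialIso P)

include hP

theorem lt_iff (i : Fin 2) {p q : G × G} (hp : p ∈ P) (hq : q ∈ P) :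
    H.lt i p.1 q.1 ↔ H.lt i p.2 q.2 := by
  rw [H.lt_iff_sub, H.lt_iff_sub i p.2]
  exact hP.pos i (q - p) (P.sub_mem hq hp)

/-- Preservation of a strict total ordering in both directions already makes the linear relation `P`
the graph of an injective function. -/
theorem eq_iff {p q : G × G} (hp : p ∈ P) (hq : q ∈ P) : p.1 = q.1 ↔ p.2 = q.2 := by
  have h1 := hP.lt_iff 0 hp hq
  have h2 := hP.lt_iff 0 hq hp
  constructor
  · intro h
    rw [h] at h1 h2
    exact ((H.lt_total 0 _ _).resolve_left fun h' => H.lt_irrefl _ _ (h1.2 h')).resolve_right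
      fun h' => H.lt_irrefl _ _ (h2.2 h')
  · intro h
    rw [h] at h1 h2
    exact ((H.lt_total 0 _ _).resolve_left fun h' => H.lt_irrefl _ _ (h1.1 h')).resolve_right
      fun h' => H.lt_irrefl _ _ (h2.1 h')

theorem topLT_iff (i : Fin 2) {a b c d : WithTop G} (h : RelTop P a b) (h' : RelTop P c d) :
    topLT (H.lt i) a c ↔ topLT (H.lt i) b d := by
  rcases h with ⟨rfl, rfl⟩ | ⟨p, hp, rfl, rfl⟩
  · exact iff_of_false not_top_topLT not_top_topLT
  · rcases h' with ⟨rfl, rfl⟩ | ⟨q, hq, rfl, rfl⟩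
    · exact iff_of_true topLT_top topLT_top
    · rw [topLT_coe, topLT_coe, hP.lt_iff i hp hq]

theorem relTop_eq_iff {a b c d : WithTop G} (h : RelTop P a b) (h' : RelTop P c d) :
    a = c ↔ b = d := by
  rcases h with ⟨rfl, rfl⟩ | ⟨p, hp, rfl, rfl⟩ <;> rcases h' with ⟨rfl, rfl⟩ | ⟨q, hq, rfl, rfl⟩
  · simp
  · simp
  · simp
  · rw [WithTop.coe_inj, WithTop.coe_inj, hP.eq_iff hp hq]

theorem symm : H.IsPartialIso (P.comap (LinearEquiv.prodComm K G G : G × G →ₗ[K] G × G)) where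
  pos i p hp := (hP.pos i _ hp).symm
  val p hp := by
    rcases hP.val _ hp with ⟨h1, h2⟩ | ⟨q, hq, h1, h2⟩
    · exact Or.inl ⟨h2, h1⟩
    · exact Or.inr ⟨q.swap, by simpa using hq, h2, h1⟩

/-- Up to a nonzero scalar, the new elements are the differences `x - p`, so the two cuts and the
values of these differences suffice. Negative scalars exchange the two sides of a cut. -/
theorem sup_span {x x' : G} (hlt : ∀ i, ∀ p ∈ P, H.lt i p.1 x ↔ H.lt i p.2 x')
    (hgt : ∀ i, ∀ p ∈ P, H.lt i x p.1 ↔ H.lt i x' p.2)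
    (hv : ∀ p ∈ P, RelTop (P ⊔ K ∙ (x, x')) (H.v (x - p.1)) (H.v (x' - p.2))) :
    H.IsPartialIso (P ⊔ K ∙ (x, x')) := by
  have key : ∀ q ∈ P ⊔ K ∙ (x, x'), q ∈ P ∨ ∃ c : K, c ≠ 0 ∧ ∃ p ∈ P,
      q.1 = c • (x - p.1) ∧ q.2 = c • (x' - p.2) := by
    intro q hq
    obtain ⟨p, hp, y, hy, rfl⟩ := Submodule.mem_sup.1 hq
    obtain ⟨c, rfl⟩ := Submodule.mem_span_singleton.1 hy
    by_cases hc : c = 0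
    · left; simpa [hc] using hp
    · refine Or.inr ⟨c, hc, -(c⁻¹ • p), P.neg_mem (P.smul_mem _ hp), ?_, ?_⟩ <;>
        simp [smul_smul, hc, add_comm]
  have smul_iff : ∀ i (c : K) (y : G), 0 < c → (H.lt i 0 (c • y) ↔ H.lt i 0 y) := by
    intro i c y hc
    refine ⟨fun h => ?_, H.smul_pos i c y hc⟩
    have := H.smul_pos i c⁻¹ _ (inv_pos.2 hc) h
    rwa [smul_smul, inv_mul_cancel₀ hc.ne', one_smul] at this
  constructor
  · intro i q hq
    rcases key q hq with hq | ⟨c, hc, p, hp, h1, h2⟩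
    · exact hP.pos i q hq
    · rw [h1, h2]
      rcases lt_or_gt_of_ne hc with hc | hc
      · have e : ∀ y z : G, c • (y - z) = (-c) • (z - y) := fun y z => by
          rw [neg_smul, ← smul_neg, neg_sub]
        rw [e, e, smul_iff _ _ _ (neg_pos.2 hc), smul_iff _ _ _ (neg_pos.2 hc), ← H.lt_iff_sub,
          ← H.lt_iff_sub]
        exact hgt i p hp
      · rw [smul_iff _ _ _ hc, smul_iff _ _ _ hc, ← H.lt_iff_sub, ← H.lt_iff_sub]
        exact hlt i p hp
  · intro q hq
    rcases key q hq with hq | ⟨c, hc, p, hp, h1, h2⟩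
    · exact (hP.val q hq).mono le_sup_left
    · rw [h1, h2, H.v_smul _ _ hc, H.v_smul _ _ hc]
      exact hv p hp

/-- A value `g` outside of the domain may be mapped to any value in the corresponding cut of the
ordering `lt 0`. -/
theorem sup_span_value {g g' : G} (hg : H.v g = g) (hg' : H.v g' = g')
    (hne : ∀ p ∈ P, p.1 ≠ g) (hlt : ∀ p ∈ P, H.lt 0 p.1 g → H.lt 0 p.2 g')
    (hgt : ∀ p ∈ P, H.lt 0 g p.1 → H.lt 0 g' p.2) : H.IsPartialIso (P ⊔ K ∙ (g, g')) := by
  have hne' : ∀ p ∈ P, p.2 ≠ g' := by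
    intro p hp h
    rcases H.lt_total 0 p.1 g with h' | h' | h'
    · exact H.lt_irrefl 0 _ (h ▸ hlt p hp h')
    · exact hne p hp h'
    · exact H.lt_irrefl 0 _ (h ▸ hgt p hp h')
  have h0 : ∀ p ∈ P, H.lt 0 p.1 g ↔ H.lt 0 p.2 g' := by
    intro p hp
    refine ⟨hlt p hp, fun h => ?_⟩
    rw [← H.not_lt_and_ne (hne p hp).symm]
    exact fun h' => H.lt_asymm h (hgt p hp h')
  have h0' := H.gt_iff_of_lt_iff 0 hne hne' h0
  -- Values of domain elements are `∞` or lie in the domain again, and `g` does not.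
  have hvne : ∀ p ∈ P, H.v p.1 ≠ g ∧ H.v p.2 ≠ g' := by
    intro p hp
    rcases hP.val p hp with ⟨h1, h2⟩ | ⟨q, hq, h1, h2⟩
    · simp [h1, h2]
    · simp [h1, h2, hne q hq, hne' q hq]
  have hvlt : ∀ p ∈ P, topLT (H.lt 0) (g : WithTop G) (H.v p.1) ↔
      topLT (H.lt 0) (g' : WithTop G) (H.v p.2) := by
    intro p hp
    rcases hP.val p hp with ⟨h1, h2⟩ | ⟨q, hq, h1, h2⟩
    · simp [h1, h2, topLT_top]
    · rw [h1, h2, topLT_coe, topLT_coe, h0' q hq]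
  -- The `lt 1`-cut is forced: relative to a value it depends only on signs and on the `lt
  -- 0`-comparison of values.
  have h1 : ∀ p ∈ P, H.lt 1 p.1 g ↔ H.lt 1 p.2 g' := by
    intro p hp
    rw [H.lt_one_value_iff hg (hvne p hp).1, H.lt_one_value_iff hg' (hvne p hp).2, hP.pos 1 p hp,
      hvlt p hp]
  have h1' := H.gt_iff_of_lt_iff 1 hne hne' h1
  refine hP.sup_span (Fin.forall_fin_two.2 ⟨h0, h1⟩) (Fin.forall_fin_two.2 ⟨h0', h1'⟩) ?_
  intro p hp
  -- Since `v p.1` differs from `g`, the value of `g - p.1` is the smaller of the two: either `g`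
  -- itself, which is new, or an old value.
  by_cases h : topLT (H.lt 0) (g : WithTop G) (H.v p.1)
  · rw [H.v_sub_of_lt (hg.symm ▸ h), H.v_sub_of_lt (hg'.symm ▸ (hvlt p hp).1 h), hg, hg', relTop_coe]
    exact Submodule.mem_sup_right (Submodule.mem_span_singleton_self _)
  · have h' := (H.topLT_total (hvne p hp).1.symm).resolve_left h
    have h'' := (H.topLT_total (hvne p hp).2.symm).resolve_left (mt (hvlt p hp).2 h)
    rw [H.v_sub_comm, H.v_sub_comm g', H.v_sub_of_lt (hg.symm ▸ h'), H.v_sub_of_lt (hg'.symm ▸ h'')]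
    exact (hP.val p hp).mono le_sup_left

end IsPartialIso

end PartialIso

/-! ### Realizing one-element extensions by saturation -/

section Saturation

/-- The subsets of a Hamel space that are defined by finitely many basic conditions. -/
inductive IsBasic : Set G → Prop
  | univ : IsBasic Set.univ
  | inter {S T : Set G} : IsBasic S → IsBasic T → IsBasic (S ∩ T)
  | lowerBound (i : Fin 2) (b : G) : IsBasic {x | H.lt i b x}
  | upperBound (i : Fin 2) (b : G) : IsBasic {x | H.lt i x b}
  | val (b g : G) : IsBasic {x | H.v (x - b) = g}
  | value : IsBasic {x | H.v x = x}

/-- Countable families of basic conditions that are finitely satisfiable are satisfiable. -/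
def IsCountablySaturated : Prop :=
  ∀ (ι : Type w) [Countable ι] (S : ι → Set G), (∀ i, H.IsBasic (S i)) →
    (∀ F : Finset ι, ∃ x, ∀ i ∈ F, x ∈ S i) → ∃ x, ∀ i, x ∈ S i

variable {H}

theorem IsBasic.imp (c : Prop) {p : G → Prop} (h : H.IsBasic {x | p x}) :
    H.IsBasic {x | c → p x} := by
  by_cases hc : c
  · simpa [hc] using h
  · simpa [hc] using IsBasic.univ

variable {P : Submodule K (G × G)} (hi : H.IsIndependent)

include hi

/-- Images of points below `x` lie below images of points above `x`. Independence enters only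
through the absence of endpoints. -/
theorem IsIndependent.exists_cut (hP : H.IsPartialIso P) (x : G) (F : Finset (G × G))
    (hF : ∀ p ∈ F, p ∈ P) : ∃ b₁ b₂, H.lt 0 b₁ b₂ ∧ ∀ y, H.lt 0 b₁ y → H.lt 0 y b₂ →
      ∀ p ∈ F, (H.lt 0 p.1 x → H.lt 0 p.2 y) ∧ (H.lt 0 x p.1 → H.lt 0 y p.2) := by
  classical
  let := H.linOrd 0
  have := hi.noMaxOrder 0
  have := hi.noMinOrder 0
  obtain ⟨b₁, b₂, hb, h1, h2⟩ := exists_lt_between_finsets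
    ((F.filter fun p => p.1 < x).image Prod.snd) ((F.filter fun p => x < p.1).image Prod.snd) (by
      simp only [Finset.forall_mem_image, Finset.mem_filter]
      rintro p ⟨hp, hpx⟩ q ⟨hq, hqx⟩
      exact (hP.lt_iff 0 (hF p hp) (hF q hq)).1 (hpx.trans hqx))
  simp only [Finset.forall_mem_image, Finset.mem_filter] at h1 h2
  exact ⟨b₁, b₂, hb, fun y hy1 hy2 p hp =>
    ⟨fun h => (h1 ⟨hp, h⟩).trans_lt hy1, fun h => lt_of_lt_of_le hy2 (h2 ⟨hp, h⟩)⟩⟩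

variable (hs : H.IsCountablySaturated)

include hs

/-- Only the `lt 0`-cut of a value has to be matched, and density places a value in every `lt
0`-interval. -/
theorem IsPartialIso.exists_sup_span_value (hd : H.IsDense) (hP : H.IsPartialIso P)
    (hc : (P : Set (G × G)).Countable) {g : G} (hg : H.v g = g) (hne : ∀ p ∈ P, p.1 ≠ g) :
    ∃ g', H.IsPartialIso (P ⊔ K ∙ (g, g')) := by
  classical
  have : Countable P := hc.to_subtype
  obtain ⟨g', hg'⟩ := hs P
    (fun p => {y | H.v y = y} ∩ ({y | H.lt 0 p.1.1 g → H.lt 0 p.1.2 y} ∩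
      {y | H.lt 0 g p.1.1 → H.lt 0 y p.1.2}))
    (fun p => .inter .value (.inter (.imp _ (.lowerBound _ _)) (.imp _ (.upperBound _ _))))
    (fun F => by
      obtain ⟨b₁, b₂, hb, h⟩ := hi.exists_cut hP g (F.image Subtype.val)
        (Finset.forall_mem_image.2 fun p _ => p.2)
      obtain ⟨c, h1, h2⟩ := hd b₁ b₂ hb
      have hc : H.v c ≠ ⊤ := by
        intro h
        rw [h] at h2
        exact not_top_topLT h2
      obtain ⟨y, hy⟩ := WithTop.ne_top_iff_exists.1 hc
      rw [← hy, topLT_coe] at h1 h2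
      exact ⟨y, fun p hp => ⟨H.v_eq_self hy.symm, h y h1 h2 p (Finset.mem_image_of_mem _ hp)⟩⟩)
  -- The condition of being a value was attached to every index in `P`; the index 0 supplies it.
  have hv : H.v g' = g' := (hg' 0).1
  exact ⟨g', hP.sup_span_value hg hv hne (fun p hp => (hg' ⟨p, hp⟩).2.1)
    (fun p hp => (hg' ⟨p, hp⟩).2.2)⟩

/-- When no new values arise, the conditions on `x'` split into an `lt 0`-cut and an `lt 1`-cut with
prescribed values. Finitely many of each kind hold throughout an interval of the respective
ordering, and independence makes the two intervals meet. -/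
theorem IsPartialIso.exists_sup_span_immediate (hP : H.IsPartialIso P)
    (hc : (P : Set (G × G)).Countable) {x : G} (hne : ∀ p ∈ P, p.1 ≠ x)
    (hx : ∀ p ∈ P, ∃ q ∈ P, H.v (x - p.1) = q.1) :
    ∃ x', H.IsPartialIso (P ⊔ K ∙ (x, x')) := by
  classical
  have : Countable P := hc.to_subtype
  choose q hq hqv using hx
  have hqv2 : ∀ p hp, H.v (q p hp).2 = (q p hp).2 := by
    intro p hp
    have h1 := hP.val _ (hq p hp)
    rw [H.v_eq_self (hqv p hp)] at h1
    exact (hP.relTop_eq_iff h1 (Or.inr ⟨_, hq p hp, rfl, rfl⟩)).1 rfl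
  obtain ⟨x', hx'⟩ := hs P
    (fun p => ({y | H.lt 0 p.1.1 x → H.lt 0 p.1.2 y} ∩ {y | H.lt 0 x p.1.1 → H.lt 0 y p.1.2}) ∩
      (({y | H.lt 1 p.1.1 x → H.lt 1 p.1.2 y} ∩ {y | H.lt 1 x p.1.1 → H.lt 1 y p.1.2}) ∩
        {y | H.v (y - p.1.2) = (q p.1 p.2).2}))
    (fun p => .inter (.inter (.imp _ (.lowerBound _ _)) (.imp _ (.upperBound _ _)))
      (.inter (.inter (.imp _ (.lowerBound _ _)) (.imp _ (.upperBound _ _))) (.val _ _)))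
    (fun F => by
      -- Inserting 0 makes the set nonempty, so that a nearest point exists.
      have hF : ∀ p ∈ insert 0 (F.image Subtype.val), p ∈ P :=
        Finset.forall_mem_insert _ _ _ |>.2 ⟨P.zero_mem, Finset.forall_mem_image.2 fun p _ => p.2⟩
      obtain ⟨b₁, b₂, hb, h⟩ := hi.exists_cut hP x _ hF
      obtain ⟨d₁, d₂, hd, h'⟩ :=
        @IsConvexValuation.exists_interval K _ G H.ValueSet _ _ (H.linOrd 1) _ H.v
          H.isConvexValuation (H.isOrderedAddMonoid 1) P (RelTop P) (hP.pos 1)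
          (fun a b c d hab hcd => hP.topLT_iff 0 hab hcd) hP.val inferInstance _ hF
          ⟨0, by simp⟩ x (fun p hp => hne p (hF p hp))
          -- The value of `x - p.1` itself serves as the required positive domain element: it is
          -- positive for `lt 1` and is its own value.
          (fun p hp => ⟨q p (hF p hp), hq p (hF p hp), H.pos_of_v_eq (hqv p (hF p hp)), by
            rw [hqv p (hF p hp)]; exact H.v_eq_self (hqv p (hF p hp))⟩)
      obtain ⟨y, h1, h2, h3, h4⟩ := hi.exists_between hb hd
      refine ⟨y, fun p hp => ?_⟩
      have hp' : p.1 ∈ insert 0 (F.image Subtype.val) :=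
        Finset.mem_insert_of_mem (Finset.mem_image_of_mem _ hp)
      obtain ⟨k1, k2, k3⟩ := h' y h3 h4 p hp'
      refine ⟨h y h1 h2 p hp', ⟨k1, k2⟩, ?_⟩
      rw [hqv p.1 p.2] at k3
      exact (hP.relTop_eq_iff k3 (Or.inr ⟨_, hq p.1 p.2, rfl, rfl⟩)).1 rfl)
  have hlt : ∀ i, ∀ p ∈ P, H.lt i p.1 x → H.lt i p.2 x' := fun i p hp => by
    have := hx' ⟨p, hp⟩
    fin_cases i
    · exact this.1.1
    · exact this.2.1.1
  have hgt : ∀ i, ∀ p ∈ P, H.lt i x p.1 → H.lt i x' p.2 := fun i p hp => by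
    have := hx' ⟨p, hp⟩
    fin_cases i
    · exact this.1.2
    · exact this.2.1.2
  refine ⟨x', hP.sup_span (fun i p hp => ⟨hlt i p hp, fun h => ?_⟩)
    (fun i p hp => ⟨hgt i p hp, fun h => ?_⟩) fun p hp => ?_⟩
  · rw [← H.not_lt_and_ne (hne p hp).symm]
    exact fun h' => H.lt_asymm h (hgt i p hp h')
  · rw [← H.not_lt_and_ne (hne p hp)]
    exact fun h' => H.lt_asymm h (hlt i p hp h')
  · have h : H.v (x' - p.2) = (q p hp).2 := (hx' ⟨p, hp⟩).2.2
    rw [hqv p hp, h, relTop_coe]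
    exact Submodule.mem_sup_left (hq p hp)

end Saturation

end HamelSpace

/-! ### Back-and-forth over countably many scalars -/

instance HamFunc.countable (K : Type u) [Countable K] : Countable (Σ n, HamFunc K n) := by
  refine Function.Surjective.countable (α := Fin 4 ⊕ K) (f := Sum.elim
    ![⟨0, .zero⟩, ⟨0, .infty⟩, ⟨2, .add⟩, ⟨1, .val⟩] fun c => ⟨1, .smul c⟩) ?_
  rintro ⟨n, f⟩
  cases f with
  | zero => exact ⟨Sum.inl 0, rfl⟩
  | infty => exact ⟨Sum.inl 1, rfl⟩
  | add => exact ⟨Sum.inl 2, rfl⟩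
  | smul c => exact ⟨Sum.inr c, rfl⟩
  | val => exact ⟨Sum.inl 3, rfl⟩

instance langHam.countable_functions (K : Type u) [Countable K] :
    Countable (Σ n, (langHam K).Functions n) :=
  HamFunc.countable K

namespace HamelSpace

variable {K : Type u} [Field K] [LinearOrder K] [IsStrictOrderedRing K]
  {G : Type w} [AddCommGroup G] [Module K G] {H : HamelSpace K G}

-- The finite elements of the substructure generated by `s` form such a subspace; it is countable
-- because there are countably many terms.
variable (H) in
theorem exists_countable_submodule [Countable K] {s : Set G} (hs : s.Countable) :
    ∃ N : Submodule K G, s ⊆ N ∧ (N : Set G).Countable ∧ ∀ x ∈ N, ∀ g : G, H.v x = g → g ∈ N := by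
  let := H.toStructure
  let N := Substructure.closure (langHam K) (((↑) : G → WithTop G) '' s)
  have hN : (N : Set (WithTop G)).Countable := by
    have : Countable (((↑) : G → WithTop G) '' s) := (hs.image _).to_subtype
    rw [Substructure.coe_closure_eq_range_term_realize]
    exact Set.countable_range _
  refine ⟨{ carrier := {g | (g : WithTop G) ∈ N}
            zero_mem' := ?_
            add_mem' := ?_
            smul_mem' := ?_ }, ?_, ?_, ?_⟩
  · intro a b ha hb
    exact N.fun_mem Ham.addS ![(a : WithTop G), b] (Fin.forall_fin_two.2 ⟨ha, hb⟩)
  · exact N.fun_mem Ham.zeroS ![] (by simp)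
  · intro c a (ha : (a : WithTop G) ∈ N)
    exact N.fun_mem (Ham.smulS c) ![(a : WithTop G)] (by simpa using ha)
  · exact fun g hg => Substructure.subset_closure (Set.mem_image_of_mem _ hg)
  · exact hN.preimage WithTop.coe_injective
  · intro a (ha : (a : WithTop G) ∈ N) g hg
    have := N.fun_mem Ham.valS ![(a : WithTop G)] (by simpa using ha)
    change H.v a ∈ N at this
    rwa [hg] at this

variable {P : Submodule K (G × G)}

/-- Adjoining `x` may first require adjoining values of differences, which create further
differences. A maximal extension with domain inside a countable `v`-closed subspace `N` containing
`x` absorbs this iteration: it contains every value in `N`, after which `x` creates no new ones. -/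
theorem IsPartialIso.exists_extension [Countable K] (hi : H.IsIndependent) (hd : H.IsDense)
    (hs : H.IsCountablySaturated) (hP : H.IsPartialIso P) (hc : (P : Set (G × G)).Countable)
    (x : G) : ∃ Q, P ≤ Q ∧ H.IsPartialIso Q ∧ (Q : Set (G × G)).Countable ∧ ∃ y, (x, y) ∈ Q := by
  obtain ⟨N, hsN, hNc, hNv⟩ := H.exists_countable_submodule
    (s := insert x (Prod.fst '' (P : Set (G × G)))) ((hc.image _).insert x)
  obtain ⟨Q, hPQ, hQ⟩ := zorn_le_nonempty₀
    {Q | H.IsPartialIso Q ∧ Q ≤ N.comap (LinearMap.fst K G G)} (by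
      intro c hcs hchain y hy
      have hmem : ∀ z, z ∈ sSup c ↔ ∃ Q ∈ c, z ∈ Q := fun z =>
        Submodule.mem_sSup_of_directed ⟨y, hy⟩ hchain.directedOn
      refine ⟨sSup c, ⟨⟨fun i p hp => ?_, fun p hp => ?_⟩, sSup_le fun Q hQ => (hcs hQ).2⟩,
        fun z hz => le_sSup hz⟩
      · obtain ⟨Q, hQ, hpQ⟩ := (hmem p).1 hp
        exact (hcs hQ).1.pos i p hpQ
      · obtain ⟨Q, hQ, hpQ⟩ := (hmem p).1 hp
        exact ((hcs hQ).1.val p hpQ).mono (le_sSup hQ)) P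
    ⟨hP, fun p hp => hsN (Set.mem_insert_of_mem _ (Set.mem_image_of_mem _ hp))⟩
  have hQi : H.IsPartialIso Q := hQ.1.1
  have hQN : Q ≤ N.comap (LinearMap.fst K G G) := hQ.1.2
  -- Countability survives the maximality argument because the first projection is injective on `Q`
  -- and lands in `N`.
  have hQc : (Q : Set (G × G)).Countable :=
    Set.MapsTo.countable_of_injOn (f := Prod.fst) (fun p hp => hQN hp)
      (fun p hp q hq h => Prod.ext h ((hQi.eq_iff hp hq).1 h)) hNc
  have hmax : ∀ g ∈ N, (∃ g', H.IsPartialIso (Q ⊔ K ∙ (g, g'))) → ∃ g', (g, g') ∈ Q := by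
    rintro g hg ⟨g', hg'⟩
    refine ⟨g', hQ.2 ⟨hg', sup_le hQN ?_⟩ le_sup_left
      (Submodule.mem_sup_right (Submodule.mem_span_singleton_self _))⟩
    rw [Submodule.span_singleton_le_iff_mem]
    exact hg
  refine ⟨Q, hPQ, hQi, hQc, ?_⟩
  by_contra hx
  have hne : ∀ p ∈ Q, p.1 ≠ x := by
    rintro p hp rfl
    exact hx ⟨p.2, hp⟩
  refine hx (hmax x (hsN (Set.mem_insert _ _))
    (hQi.exists_sup_span_immediate hi hs hQc hne fun p hp => ?_))
  obtain ⟨g, hg⟩ := H.exists_v_eq_coe (sub_ne_zero.2 (hne p hp).symm)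
  have hgN : g ∈ N := hNv (x - p.1) (N.sub_mem (hsN (Set.mem_insert _ _)) (hQN hp)) g hg
  by_cases h : ∃ q ∈ Q, q.1 = g
  · obtain ⟨q, hq, rfl⟩ := h
    exact ⟨q, hq, hg⟩
  · push Not at h
    obtain ⟨g', hg'⟩ := hmax g hgN (hQi.exists_sup_span_value hi hs hd hQc (H.v_eq_self hg) h)
    exact absurd rfl (h _ hg')

theorem IsPartialIso.exists_extension_symm [Countable K] (hi : H.IsIndependent) (hd : H.IsDense)
    (hs : H.IsCountablySaturated) (hP : H.IsPartialIso P) (hc : (P : Set (G × G)).Countable)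
    (y : G) : ∃ Q, P ≤ Q ∧ H.IsPartialIso Q ∧ (Q : Set (G × G)).Countable ∧ ∃ x, (x, y) ∈ Q := by
  have hinj := Prod.swap_injective (α := G) (β := G)
  obtain ⟨Q, hPQ, hQ, hQc, x, hx⟩ := hP.symm.exists_extension hi hd hs
    (hc.preimage hinj) y
  exact ⟨_, fun p hp => hPQ (x := p.swap) hp, hQ.symm, hQc.preimage hinj, x, hx⟩

theorem IsPartialIso.relTop_realize (hP : H.IsPartialIso P) {α : Type*} {e e' : α → WithTop G}
    (he : ∀ a, RelTop P (e a) (e' a)) (t : (langHam K).Term α) :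
    letI := H.toStructure
    RelTop P (t.realize e) (t.realize e') := by
  let := H.toStructure
  induction t with
  | var a => exact he a
  | func f ts ih =>
    cases f with
    | zero => exact relTop_coe.2 P.zero_mem
    | infty => exact Or.inl ⟨rfl, rfl⟩
    | add =>
      change RelTop P ((ts 0).realize e + (ts 1).realize e) ((ts 0).realize e' + (ts 1).realize e')
      rcases ih 0 with ⟨h1, h2⟩ | ⟨p, hp, h1, h2⟩
      · exact Or.inl (by simp [h1, h2])
      · rcases ih 1 with ⟨h3, h4⟩ | ⟨q, hq, h3, h4⟩
        · exact Or.inl (by simp [h3, h4])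
        · exact Or.inr ⟨p + q, P.add_mem hp hq, by simp [h1, h3], by simp [h2, h4]⟩
    | smul c =>
      change RelTop P (((ts 0).realize e).map (c • ·)) (((ts 0).realize e').map (c • ·))
      rcases ih 0 with ⟨h1, h2⟩ | ⟨p, hp, h1, h2⟩
      · exact Or.inl (by simp [h1, h2])
      · exact Or.inr ⟨c • p, P.smul_mem c hp, by simp [h1], by simp [h2]⟩
    | val =>
      change RelTop P (((ts 0).realize e).recTopCoe ⊤ H.v) (((ts 0).realize e').recTopCoe ⊤ H.v)
      rcases ih 0 with ⟨h1, h2⟩ | ⟨p, hp, h1, h2⟩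
      · exact Or.inl (by simp [h1, h2])
      · rw [h1, h2]
        exact hP.val p hp

/-- The partial isomorphism is quantified inside the induction, since each quantifier over a finite
element enlarges it; `∞` is always related to itself. -/
theorem realize_iff_of_isPartialIso [Countable K] (hi : H.IsIndependent) (hd : H.IsDense)
    (hs : H.IsCountablySaturated) {α : Type*} {n : ℕ} (φ : (langHam K).BoundedFormula α n) :
    letI := H.toStructure
    ∀ (P : Submodule K (G × G)), H.IsPartialIso P → (P : Set (G × G)).Countable →
    ∀ (e e' : α → WithTop G) (xs xs' : Fin n → WithTop G), (∀ a, RelTop P (e a) (e' a)) →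
    (∀ i, RelTop P (xs i) (xs' i)) → (φ.Realize e xs ↔ φ.Realize e' xs') := by
  let := H.toStructure
  induction φ with
  | falsum => exact fun _ _ _ _ _ _ _ _ _ => Iff.rfl
  | equal t₁ t₂ =>
    intro P hP hc e e' xs xs' he hxs
    exact hP.relTop_eq_iff (hP.relTop_realize (RelTop.sumElim he hxs) t₁)
      (hP.relTop_realize (RelTop.sumElim he hxs) t₂)
  | rel R ts =>
    intro P hP hc e e' xs xs' he hxs
    cases R with
    | lt i =>
      exact hP.topLT_iff i (hP.relTop_realize (RelTop.sumElim he hxs) (ts 0))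
        (hP.relTop_realize (RelTop.sumElim he hxs) (ts 1))
  | imp φ ψ ih ih' =>
    intro P hP hc e e' xs xs' he hxs
    exact imp_congr (ih P hP hc e e' xs xs' he hxs) (ih' P hP hc e e' xs xs' he hxs)
  | all φ ih =>
    intro P hP hc e e' xs xs' he hxs
    simp only [BoundedFormula.realize_all]
    constructor
    · intro h y
      cases y with
      | top => exact (ih P hP hc e e' _ _ he (RelTop.snoc hxs (Or.inl ⟨rfl, rfl⟩))).1 (h ⊤)
      | coe y =>
        obtain ⟨Q, hPQ, hQ, hQc, x, hx⟩ := hP.exists_extension_symm hi hd hs hc y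
        exact (ih Q hQ hQc e e' _ _ (fun a => (he a).mono hPQ)
          (RelTop.snoc (fun i => (hxs i).mono hPQ) (relTop_coe.2 hx))).1 (h x)
    · intro h x
      cases x with
      | top => exact (ih P hP hc e e' _ _ he (RelTop.snoc hxs (Or.inl ⟨rfl, rfl⟩))).2 (h ⊤)
      | coe x =>
        obtain ⟨Q, hPQ, hQ, hQc, y, hy⟩ := hP.exists_extension hi hd hs hc x
        exact (ih Q hQ hQc e e' _ _ (fun a => (he a).mono hPQ)
          (RelTop.snoc (fun i => (hxs i).mono hPQ) (relTop_coe.2 hy))).2 (h y)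

/-- In a countably saturated Hamel space, tuples with the same quantifier-free type have the same
type. -/
theorem realize_iff_of_quantifierFree [Countable K] (hi : H.IsIndependent) (hd : H.IsDense)
    (hs : H.IsCountablySaturated) {α : Type*} [Countable α] {e e' : α → WithTop G}
    (heq : letI := H.toStructure
      ∀ s t : (langHam K).Term α, s.realize e = t.realize e ↔ s.realize e' = t.realize e')
    (hlt : letI := H.toStructure
      ∀ i, ∀ s t : (langHam K).Term α, topLT (H.lt i) (s.realize e) (t.realize e) ↔
        topLT (H.lt i) (s.realize e') (t.realize e')) (φ : (langHam K).Formula α) :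
    letI := H.toStructure
    (φ.Realize e ↔ φ.Realize e') := by
  let := H.toStructure
  -- The correspondence between the finite values of the same term at `e` and at `e'`; it is linear
  -- because `0`, `+` and the scalars are symbols of the language.
  let P : Submodule K (G × G) :=
    { carrier := {p | ∃ t : (langHam K).Term α, t.realize e = p.1 ∧ t.realize e' = p.2}
      zero_mem' := ⟨Ham.zeroT, Ham.realize_zeroT e, Ham.realize_zeroT e'⟩
      add_mem' := by
        rintro p q ⟨s, hs1, hs2⟩ ⟨t, ht1, ht2⟩
        refine ⟨Ham.addT s t, ?_, ?_⟩
        · rw [Ham.realize_addT, hs1, ht1]; rfl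
        · rw [Ham.realize_addT, hs2, ht2]; rfl
      smul_mem' := by
        rintro c p ⟨s, hs1, hs2⟩
        refine ⟨Ham.smulT c s, ?_, ?_⟩
        · rw [Ham.realize_smulT, hs1]; rfl
        · rw [Ham.realize_smulT, hs2]; rfl }
  have htop : ∀ t : (langHam K).Term α, t.realize e = ⊤ ↔ t.realize e' = ⊤ := by
    intro t
    have := heq t Ham.inftyT
    rwa [Ham.realize_inftyT, Ham.realize_inftyT] at this
  have hrel : ∀ t : (langHam K).Term α, RelTop P (t.realize e) (t.realize e') := by
    intro t
    by_cases h : t.realize e = ⊤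
    · exact Or.inl ⟨h, (htop t).1 h⟩
    · obtain ⟨x, hx⟩ := WithTop.ne_top_iff_exists.1 h
      obtain ⟨y, hy⟩ := WithTop.ne_top_iff_exists.1 (mt (htop t).2 h)
      exact Or.inr ⟨(x, y), ⟨t, hx.symm, hy.symm⟩, hx.symm, hy.symm⟩
  have hP : H.IsPartialIso P := by
    constructor
    · rintro i p ⟨t, ht, ht'⟩
      have := hlt i Ham.zeroT t
      rw [Ham.realize_zeroT, Ham.realize_zeroT, ht, ht'] at this
      exact (topLT_coe.symm.trans this).trans topLT_coe
    · rintro p ⟨t, ht, ht'⟩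
      have := hrel (Ham.valT t)
      rw [Ham.realize_valT, Ham.realize_valT, ht, ht'] at this
      exact this
  have hc : (P : Set (G × G)).Countable := by
    refine (Set.countable_range fun t : (langHam K).Term α =>
      ((t.realize e).untopD 0, (t.realize e').untopD 0)).mono ?_
    rintro p ⟨t, ht, ht'⟩
    exact ⟨t, by simp [ht, ht']⟩
  exact realize_iff_of_isPartialIso hi hd hs φ P hP hc e e' _ _ (fun a => hrel (.var a))
    finZeroElim

end HamelSpace

/-! ### Shrinking infinite sets of indices -/

section InfiniteSets

open Filter

/-- A property of natural numbers is decided along `I` if it holds for almost all elements of `I`,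
or fails for almost all of them. -/
def DecidedAlong (I : Set ℕ) (p : ℕ → Prop) : Prop :=
  (∀ᶠ n in atTop ⊓ 𝓟 I, p n) ∨ ∀ᶠ n in atTop ⊓ 𝓟 I, ¬ p n

theorem atTop_inf_principal_le {I J : Set ℕ} (h : (J \ I).Finite) :
    (atTop ⊓ 𝓟 J : Filter ℕ) ≤ atTop ⊓ 𝓟 I := by
  refine le_inf inf_le_left (le_principal_iff.2 ?_)
  rw [← Nat.cofinite_eq_atTop, mem_inf_principal, mem_cofinite]
  exact h.subset fun n hn => by simpa using hn

theorem eventually_atTop_inf_principal_of_forall {I : Set ℕ} {p : ℕ → Prop} (h : ∀ n ∈ I, p n) :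
    ∀ᶠ n in atTop ⊓ 𝓟 I, p n :=
  eventually_inf_principal.2 (Eventually.of_forall h)

theorem DecidedAlong.mono {I J : Set ℕ} {p : ℕ → Prop} (h : (J \ I).Finite)
    (hI : DecidedAlong I p) : DecidedAlong J p :=
  hI.imp (fun h' => h'.filter_mono (atTop_inf_principal_le h))
    (fun h' => h'.filter_mono (atTop_inf_principal_le h))

theorem DecidedAlong.congr {I : Set ℕ} {p q : ℕ → Prop} (h : ∀ᶠ n in atTop ⊓ 𝓟 I, p n ↔ q n)
    (hp : DecidedAlong I p) : DecidedAlong I q :=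
  hp.imp (fun h' => (h.and h').mono fun _ hn => hn.1.1 hn.2)
    (fun h' => (h.and h').mono fun _ hn => (not_congr hn.1).1 hn.2)

theorem exists_infinite_subset_forall_or_forall_not {I : Set ℕ} (hI : I.Infinite) (p : ℕ → Prop) :
    ∃ J ⊆ I, J.Infinite ∧ ((∀ n ∈ J, p n) ∨ ∀ n ∈ J, ¬ p n) := by
  by_cases h : (I ∩ {n | p n}).Infinite
  · exact ⟨_, Set.inter_subset_left, h, Or.inl fun n hn => hn.2⟩
  · refine ⟨I \ {n | p n}, Set.sdiff_subset, fun h' => hI ?_, Or.inr fun n hn => hn.2⟩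
    rw [← Set.inter_union_sdiff I {n | p n}]
    exact (Set.not_infinite.1 h).union h'

/-- Countably many properties that can be achieved by shrinking an infinite set, and are preserved
by almost inclusion, can be achieved simultaneously. -/
theorem exists_infinite_subset_forall {ι : Type*} [Countable ι] {R : ι → Set ℕ → Prop}
    (hmono : ∀ k I J, (J \ I).Finite → R k I → R k J) {I₀ : Set ℕ} (h₀ : I₀.Infinite)
    (hex : ∀ k, ∀ I ⊆ I₀, I.Infinite → ∃ J ⊆ I, J.Infinite ∧ R k J) :
    ∃ I ⊆ I₀, I.Infinite ∧ ∀ k, R k I := by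
  rcases isEmpty_or_nonempty ι with hι | hι
  · exact ⟨I₀, subset_rfl, h₀, isEmptyElim⟩
  obtain ⟨e, he⟩ := exists_surjective_nat ι
  let X := {I : Set ℕ // I ⊆ I₀ ∧ I.Infinite}
  have hstep : ∀ (k : ℕ) (x : X × ℕ), ∃ y : X × ℕ, y.1.1 ⊆ x.1.1 ∧ R (e k) y.1.1 ∧ y.2 ∈ y.1.1 ∧
      x.2 < y.2 := by
    rintro k ⟨⟨I, hI, hI'⟩, n⟩
    obtain ⟨J, hJ, hJ', hR⟩ := hex (e k) I hI hI'
    obtain ⟨m, hm, hnm⟩ := hJ'.exists_gt n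
    exact ⟨⟨⟨J, hJ.trans hI, hJ'⟩, m⟩, hJ, hR, hm, hnm⟩
  choose f hf1 hf2 hf3 hf4 using hstep
  let g : ℕ → X × ℕ := fun k => Nat.rec ⟨⟨I₀, subset_rfl, h₀⟩, 0⟩ f k
  have hg : ∀ k, g (k + 1) = f k (g k) := fun _ => rfl
  have hanti : Antitone fun k => (g k).1.1 := antitone_nat_of_succ_le fun k => hf1 k (g k)
  have hmonog : StrictMono fun k => (g k).2 := strictMono_nat_of_lt_succ fun k => hf4 k (g k)
  have hmem : ∀ k j, k ≤ j → (g (j + 1)).2 ∈ (g (k + 1)).1.1 := fun k j hkj =>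
    hanti (Nat.succ_le_succ hkj) (hf3 j (g j))
  refine ⟨Set.range fun k => (g (k + 1)).2, ?_, ?_, ?_⟩
  · rintro _ ⟨k, rfl⟩
    exact (g (k + 1)).1.2.1 (hmem k k le_rfl)
  · exact Set.infinite_range_of_injective
      (hmonog.injective.comp (add_left_injective 1))
  · intro k
    obtain ⟨k, rfl⟩ := he k
    refine hmono _ (g (k + 1)).1.1 _ ?_ (hf2 k (g k))
    refine ((Set.finite_lt_nat k).image fun j => (g (j + 1)).2).subset ?_
    rintro _ ⟨⟨j, rfl⟩, hj⟩
    exact ⟨j, not_le.1 fun h => hj (hmem k j h), rfl⟩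

/-- A strictly monotone sequence ends up strictly on one side of any threshold, so one subsequence
serves all `r` simultaneously. -/
theorem exists_infinite_subset_const_or_decided {X : Type*} [LinearOrder X] (x : ℕ → X)
    {I : Set ℕ} (hI : I.Infinite) : ∃ J ⊆ I, J.Infinite ∧ ((∃ c, ∀ j ∈ J, x j = c) ∨
      ∀ r, (∀ᶠ j in atTop ⊓ 𝓟 J, x j < r) ∨ ∀ᶠ j in atTop ⊓ 𝓟 J, r < x j) := by
  have : Infinite I := hI.to_subtype
  classical
  let g := Nat.orderEmbeddingOfSet I
  have hg : ∀ n, g n ∈ I := fun n => Nat.orderEmbeddingOfSet_range I ▸ Set.mem_range_self n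
  have key : ∀ h : ℕ ↪o ℕ, (∀ m n, m < n → x (g (h m)) < x (g (h n))) ∨
      (∀ m n, m < n → x (g (h n)) < x (g (h m))) ∨ (∃ c, ∀ n, x (g (h n)) = c) →
      ∃ J ⊆ I, J.Infinite ∧ ((∃ c, ∀ j ∈ J, x j = c) ∨
      ∀ r, (∀ᶠ j in atTop ⊓ 𝓟 J, x j < r) ∨ ∀ᶠ j in atTop ⊓ 𝓟 J, r < x j) := by
    intro h hh
    have hev : ∀ (p : ℕ → Prop) n, (∀ m, n < m → p (g (h m))) →
        ∀ᶠ j in atTop ⊓ 𝓟 (Set.range (g ∘ h)), p j := by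
      intro p n hp
      rw [eventually_inf_principal]
      filter_upwards [eventually_gt_atTop (g (h n))]
      rintro _ hlt ⟨m, rfl⟩
      exact hp m (h.lt_iff_lt.1 (g.lt_iff_lt.1 hlt))
    refine ⟨Set.range (g ∘ h), Set.range_subset_iff.2 fun n => hg _,
      Set.infinite_range_of_injective (g.injective.comp h.injective), ?_⟩
    rcases hh with hh | hh | ⟨c, hc⟩
    · refine Or.inr fun r => ?_
      by_cases hr : ∃ n, r < x (g (h n))
      · obtain ⟨n, hn⟩ := hr
        exact Or.inr (hev _ n fun m hm => hn.trans (hh _ _ hm))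
      · push Not at hr
        exact Or.inl (hev _ 0 fun m _ => (hh m (m + 1) m.lt_succ_self).trans_le (hr _))
    · refine Or.inr fun r => ?_
      by_cases hr : ∃ n, x (g (h n)) < r
      · obtain ⟨n, hn⟩ := hr
        exact Or.inl (hev _ n fun m hm => (hh _ _ hm).trans hn)
      · push Not at hr
        exact Or.inr (hev _ 0 fun m _ => (hr _).trans_lt (hh m (m + 1) m.lt_succ_self))
    · exact Or.inl ⟨c, Set.forall_mem_range.2 hc⟩
  -- Applying the Ramsey dichotomy to `<` and then to `>` leaves a constant subsequence if neither
  -- yields a strictly monotone one.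
  obtain ⟨h₁, hh₁⟩ := exists_increasing_or_nonincreasing_subseq (· < ·) (x ∘ g)
  obtain ⟨h₂, hh₂⟩ := exists_increasing_or_nonincreasing_subseq (· > ·) (x ∘ g ∘ h₁)
  refine key (h₂.trans h₁) ?_
  rcases hh₁ with hh₁ | hh₁
  · exact Or.inl fun m n hmn => hh₁ _ _ (h₂.lt_iff_lt.2 hmn)
  rcases hh₂ with hh₂ | hh₂
  · exact Or.inr (Or.inl fun m n hmn => hh₂ m n hmn)
  refine Or.inr (Or.inr ⟨x (g (h₁ (h₂ 0))), fun n => ?_⟩)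
  rcases n.eq_zero_or_pos with rfl | hn
  · rfl
  · exact le_antisymm (not_lt.1 (hh₁ _ _ (h₂.lt_iff_lt.2 hn))) (not_lt.1 (hh₂ _ _ hn))

end InfiniteSets

/-! ### Eventual behaviour of terms along subsequences -/

namespace HamelSpace

open Filter

variable {K : Type u} [Field K] [LinearOrder K] [IsStrictOrderedRing K]
  {G : Type w} [AddCommGroup G] [Module K G] (H : HamelSpace K G)

theorem v_sub_eventually_const {ι : Type*} {l : Filter ι} {x : G} {y : ι → G} {c : WithTop G}
    (hc : c ≠ H.v x) (hy : ∀ᶠ n in l, H.v (y n) = c) : ∃ d, ∀ᶠ n in l, H.v (x - y n) = d := by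
  rcases H.topLT_total hc with h | h
  · refine ⟨c, hy.mono fun n hn => ?_⟩
    rw [H.v_sub_comm, H.v_sub_of_lt (hn.symm ▸ h), hn]
  · exact ⟨H.v x, hy.mono fun n hn => H.v_sub_of_lt (hn.symm ▸ h)⟩

/-- After passing to a subsequence, the values `v (a n + w)` are eventually constant, or eventually
given by a sequence that does not depend on `w`. -/
theorem exists_v_add_eq (a : ℕ → G) {I : Set ℕ} (hI : I.Infinite) :
    ∃ J ⊆ I, J.Infinite ∧ ∃ t : ℕ → WithTop G, ∀ w : G,
      (∃ c, ∀ᶠ n in atTop ⊓ 𝓟 J, H.v (a n + w) = c) ∨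
        ∀ᶠ n in atTop ⊓ 𝓟 J, H.v (a n + w) = t n := by
  have e : ∀ k n w, a n + w = (a k + w) - (a k - a n) := fun k n w => by abel
  -- If the values of `a k - a j` are decided against every threshold for some base point `k`, they
  -- eventually differ from `v (a k + w)`, and `v (a n + w)` is the smaller of the two.
  by_cases h : ∃ k, ∃ J ⊆ I, J.Infinite ∧ ∀ r,
      (∀ᶠ j in atTop ⊓ 𝓟 J, topLT (H.lt 0) (H.v (a k - a j)) r) ∨
        ∀ᶠ j in atTop ⊓ 𝓟 J, topLT (H.lt 0) r (H.v (a k - a j))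
  · obtain ⟨k, J, hJI, hJ, hr⟩ := h
    refine ⟨J, hJI, hJ, fun n => H.v (a k - a n), fun w => ?_⟩
    rcases hr (H.v (a k + w)) with h | h
    · refine Or.inr (h.mono fun n hn => ?_)
      rw [e k, H.v_sub_comm, H.v_sub_of_lt hn]
    · refine Or.inl ⟨H.v (a k + w), h.mono fun n hn => ?_⟩
      rw [e k, H.v_sub_of_lt hn]
  -- Otherwise `v (a k - a j)` can be made eventually constant in `j`, equal to `t k`, for all `k`
  -- at once. A single `k` with `t k ≠ v (a k + w)` makes `v (a n + w)` eventually constant; if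
  -- there is none, `v (a n + w) = t n` for all `n`.
  · obtain ⟨J, hJI, hJ, hc⟩ := exists_infinite_subset_forall (ι := ℕ)
      (R := fun k J => ∃ c, ∀ᶠ j in atTop ⊓ 𝓟 J, H.v (a k - a j) = c)
      (fun k I J hIJ ⟨c, hc⟩ => ⟨c, hc.filter_mono (atTop_inf_principal_le hIJ)⟩) hI (by
        intro k I' hI' hinf
        obtain ⟨J, hJI, hJ, hc | hr⟩ := exists_infinite_subset_const_or_decided (X := H.ValueSet)
          (fun j => H.v (a k - a j)) hinf
        · exact ⟨J, hJI, hJ, hc.imp fun c hc => eventually_atTop_inf_principal_of_forall hc⟩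
        · exact absurd ⟨k, J, hJI.trans hI', hJ, hr⟩ h)
    choose t ht using hc
    refine ⟨J, hJI, hJ, t, fun w => ?_⟩
    by_cases hw : ∃ k, t k ≠ H.v (a k + w)
    · obtain ⟨k, hk⟩ := hw
      obtain ⟨d, hd⟩ := H.v_sub_eventually_const hk (ht k)
      exact Or.inl ⟨d, hd.mono fun n hn => e k n w ▸ hn⟩
    · push Not at hw
      exact Or.inr (Eventually.of_forall fun n => (hw n).symm)

/-- The Hamel valuation on `G ∪ {∞}`. -/
def vTop (x : WithTop G) : WithTop G := x.recTopCoe ⊤ H.v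

/-- Along `I`, the functions `τ b` are eventually translates of members of a countable set of
sequences. -/
def IsControlled {G : Type*} [AddCommGroup G] {β : Type*} (I : Set ℕ) (τ : β → ℕ → WithTop G) :
    Prop :=
  ∃ S : Set (ℕ → WithTop G), S.Countable ∧
    ∀ b, ∃ s ∈ S, ∃ w, ∀ᶠ n in atTop ⊓ 𝓟 I, τ b n = s n + w

theorem IsControlled.mono {G : Type*} [AddCommGroup G] {β : Type*} {I J : Set ℕ}
    {τ : β → ℕ → WithTop G} (h : (J \ I).Finite) : IsControlled I τ → IsControlled J τ :=
  fun ⟨S, hS, hτ⟩ => ⟨S, hS, fun b =>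
    let ⟨s, hs, w, hw⟩ := hτ b
    ⟨s, hs, w, hw.filter_mono (atTop_inf_principal_le h)⟩⟩

/-- Each of the countably many controlling sequences contributes one new sequence; the eventually
constant outcomes are translates of 0. -/
theorem IsControlled.exists_v {β : Type*} {I : Set ℕ} (hI : I.Infinite)
    {τ : β → ℕ → WithTop G} (hτ : IsControlled I τ) :
    ∃ J ⊆ I, J.Infinite ∧ IsControlled J fun b n => H.vTop (τ b n) := by
  obtain ⟨S, hS, hτ⟩ := hτ
  have : Countable S := hS.to_subtype
  obtain ⟨J, hJI, hJ, hJS⟩ := exists_infinite_subset_forall (ι := S)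
    (R := fun s J => ∃ t : ℕ → WithTop G, ∀ w : WithTop G,
      (∃ c, ∀ᶠ n in atTop ⊓ 𝓟 J, H.vTop (s.1 n + w) = c) ∨
        ∀ᶠ n in atTop ⊓ 𝓟 J, H.vTop (s.1 n + w) = t n)
    (fun s I J hIJ ⟨t, ht⟩ => ⟨t, fun w => (ht w).imp
      (fun ⟨c, hc⟩ => ⟨c, hc.filter_mono (atTop_inf_principal_le hIJ)⟩)
      fun h => h.filter_mono (atTop_inf_principal_le hIJ)⟩) hI (by
    rintro ⟨s, -⟩ I' - hinf
    obtain ⟨J, hJI, hJ, h | h⟩ := exists_infinite_subset_forall_or_forall_not hinf fun n => s n = ⊤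
    · refine ⟨J, hJI, hJ, fun _ => ⊤, fun w => Or.inr ?_⟩
      refine eventually_atTop_inf_principal_of_forall fun n hn => ?_
      change H.vTop (s n + w) = ⊤
      rw [h n hn, WithTop.top_add]
      rfl
    · obtain ⟨J', hJJ, hJ', t, ht⟩ := H.exists_v_add_eq (fun n => (s n).untopD 0) hJ
      refine ⟨J', hJJ.trans hJI, hJ', t, fun w => ?_⟩
      cases w with
      | top =>
        refine Or.inl ⟨⊤, Eventually.of_forall fun n => ?_⟩
        change H.vTop (s n + ⊤) = ⊤
        rw [WithTop.add_top]
        rfl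
      | coe w =>
        have e : ∀ n ∈ J', s n + w = (((s n).untopD 0 + w : G) : WithTop G) := by
          intro n hn
          obtain ⟨x, hx⟩ := WithTop.ne_top_iff_exists.1 (h n (hJJ hn))
          rw [← hx]
          rfl
        have e' : ∀ᶠ n in atTop ⊓ 𝓟 J',
            H.vTop (s n + w) = H.v ((s n).untopD 0 + w) :=
          eventually_atTop_inf_principal_of_forall fun n hn => by rw [e n hn]; rfl
        exact (ht w).imp
          (fun ⟨c, hc⟩ => ⟨c, (e'.and hc).mono fun n hn => hn.1.trans hn.2⟩)
          (fun hc => (e'.and hc).mono fun n hn => hn.1.trans hn.2))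
  choose t ht using hJS
  refine ⟨J, hJI, hJ, insert 0 (Set.range t), (Set.countable_range t).insert 0, fun b => ?_⟩
  obtain ⟨s, hs, w, hw⟩ := hτ b
  have hw' := hw.filter_mono (atTop_inf_principal_le
    (Set.sdiff_eq_empty.2 hJI ▸ Set.finite_empty : (J \ I).Finite))
  rcases ht ⟨s, hs⟩ w with ⟨c, hc⟩ | hc
  · exact ⟨0, Set.mem_insert _ _, c, (hw'.and hc).mono fun n hn => by
      dsimp only
      rw [hn.1, hn.2, Pi.zero_apply, zero_add]⟩
  · exact ⟨t ⟨s, hs⟩, Set.mem_insert_of_mem _ (Set.mem_range_self _), 0,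
      (hw'.and hc).mono fun n hn => by
      dsimp only
      rw [hn.1, hn.2, add_zero]⟩

theorem IsControlled.add {G : Type*} [AddCommGroup G] {β : Type*} {I : Set ℕ}
    {τ σ : β → ℕ → WithTop G} :
    IsControlled I τ → IsControlled I σ → IsControlled I fun b n => τ b n + σ b n := by
  rintro ⟨S, hS, hτ⟩ ⟨T, hT, hσ⟩
  refine ⟨Set.image2 (· + ·) S T, hS.image2 hT _, fun b => ?_⟩
  obtain ⟨s, hs, w, hw⟩ := hτ b
  obtain ⟨t, ht, z, hz⟩ := hσ b
  refine ⟨s + t, Set.mem_image2_of_mem hs ht, w + z, (hw.and hz).mono fun n hn => ?_⟩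
  dsimp only
  rw [hn.1, hn.2, Pi.add_apply, add_add_add_comm]

theorem IsControlled.smul {K : Type*} [Field K] {G : Type*} [AddCommGroup G] [Module K G]
    {β : Type*} {I : Set ℕ} {τ : β → ℕ → WithTop G} (c : K) :
    IsControlled I τ → IsControlled I fun b n => (τ b n).map (c • ·) := by
  rintro ⟨S, hS, hτ⟩
  refine ⟨(fun s n => (s n).map (c • ·)) '' S, hS.image _, fun b => ?_⟩
  obtain ⟨s, hs, w, hw⟩ := hτ b
  refine ⟨_, Set.mem_image_of_mem _ hs, w.map (c • ·), hw.mono fun n hn => ?_⟩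
  dsimp only
  rw [hn]
  cases s n <;> cases w <;> simp [← WithTop.coe_add]

/-- The set `J` must not depend on `b`: the parameters are absorbed entirely by the translations. -/
theorem exists_isControlled_term {α β : Type*} (a : ℕ → α → WithTop G)
    (t : (langHam K).Term (α ⊕ β)) :
    letI := H.toStructure
    ∀ {I : Set ℕ}, I.Infinite → ∃ J ⊆ I, J.Infinite ∧
      IsControlled J fun (b : β → WithTop G) n => t.realize (Sum.elim (a n) b) := by
  let := H.toStructure
  induction t with
  | var x =>
    intro I hI
    refine ⟨I, subset_rfl, hI, ?_⟩
    cases x with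
    | inl i =>
      exact ⟨{fun n => a n i}, Set.countable_singleton _, fun b => ⟨_, Set.mem_singleton _, 0,
        Eventually.of_forall fun n => by simp⟩⟩
    | inr j =>
      exact ⟨{0}, Set.countable_singleton _, fun b => ⟨_, Set.mem_singleton _, b j,
        Eventually.of_forall fun n => by simp⟩⟩
  | func f ts ih =>
    intro I hI
    obtain ⟨J, hJI, hJ, h⟩ := exists_infinite_subset_forall
      (R := fun k J => IsControlled J fun (b : β → WithTop G) n => (ts k).realize (Sum.elim (a n) b))
      (fun k I J => IsControlled.mono) hI fun k I _ hI => ih k hI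
    cases f with
    | zero =>
      exact ⟨J, hJI, hJ, {0}, Set.countable_singleton _, fun b => ⟨_, Set.mem_singleton _, 0,
        Eventually.of_forall fun n => (add_zero _).symm⟩⟩
    | infty =>
      exact ⟨J, hJI, hJ, {0}, Set.countable_singleton _, fun b => ⟨_, Set.mem_singleton _, ⊤,
        Eventually.of_forall fun n => (WithTop.add_top _).symm⟩⟩
    | add => exact ⟨J, hJI, hJ, (h 0).add (h 1)⟩
    | smul c => exact ⟨J, hJI, hJ, (h 0).smul c⟩
    | val =>
      obtain ⟨J', hJJ, hJ', h'⟩ := (h 0).exists_v H hJ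
      exact ⟨J', hJJ.trans hJI, hJ', h'⟩

/-- For finite terms the inequality says `s n - t n < z - w`, so the single sequence of differences
has to be decided against all thresholds. -/
theorem exists_decidedAlong_lt (i : Fin 2) (s t : ℕ → WithTop G) {I : Set ℕ} (hI : I.Infinite) :
    ∃ J ⊆ I, J.Infinite ∧ ∀ w z : WithTop G,
      DecidedAlong J fun n => topLT (H.lt i) (s n + w) (t n + z) := by
  obtain ⟨J, hJI, hJ, h | h⟩ := exists_infinite_subset_forall_or_forall_not hI fun n => s n = ⊤
  · refine ⟨J, hJI, hJ, fun w z => Or.inr (eventually_atTop_inf_principal_of_forall fun n hn => ?_)⟩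
    dsimp only
    rw [h n hn, WithTop.top_add]
    exact not_top_topLT
  obtain ⟨J', hJJ, hJ', h' | h'⟩ := exists_infinite_subset_forall_or_forall_not hJ fun n => t n = ⊤
  · refine ⟨J', hJJ.trans hJI, hJ', fun w z => ?_⟩
    cases w with
    | top => exact Or.inr (Eventually.of_forall fun n => by
        dsimp only
        rw [WithTop.add_top]
        exact not_top_topLT)
    | coe w =>
      refine Or.inl (eventually_atTop_inf_principal_of_forall fun n hn => ?_)
      obtain ⟨x, hx⟩ := WithTop.ne_top_iff_exists.1 (h n (hJJ hn))
      rw [h' n hn, WithTop.top_add, ← hx, ← WithTop.coe_add]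
      exact topLT_top
  · let := H.linOrd i
    let d : ℕ → G := fun n => (s n).untopD 0 - (t n).untopD 0
    obtain ⟨J'', hJJ', hJ'', hd⟩ := exists_infinite_subset_const_or_decided d hJ'
    refine ⟨J'', (hJJ'.trans hJJ).trans hJI, hJ'', fun w z => ?_⟩
    cases w with
    | top => exact Or.inr (Eventually.of_forall fun n => by
        dsimp only
        rw [WithTop.add_top]
        exact not_top_topLT)
    | coe w =>
      have key : ∀ n ∈ J'', ∃ x y : G, s n = x ∧ t n = y ∧ d n = x - y := by
        intro n hn
        obtain ⟨x, hx⟩ := WithTop.ne_top_iff_exists.1 (h n (hJJ (hJJ' hn)))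
        obtain ⟨y, hy⟩ := WithTop.ne_top_iff_exists.1 (h' n (hJJ' hn))
        exact ⟨x, y, hx.symm, hy.symm, by simp [d, ← hx, ← hy]⟩
      cases z with
      | top =>
        refine Or.inl (eventually_atTop_inf_principal_of_forall fun n hn => ?_)
        obtain ⟨x, y, hx, hy, -⟩ := key n hn
        rw [hx, WithTop.add_top, ← WithTop.coe_add]
        exact topLT_top
      | coe z =>
        have hiff : ∀ᶠ n in atTop ⊓ 𝓟 J'', d n < z - w ↔ topLT (H.lt i) (s n + w) (t n + z) := by
          refine eventually_atTop_inf_principal_of_forall fun n hn => ?_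
          obtain ⟨x, y, hx, hy, hd⟩ := key n hn
          rw [hx, hy, ← WithTop.coe_add, ← WithTop.coe_add, topLT_coe, H.lt_iff_sub, hd]
          refine (H.lt_iff_sub i _ _).trans ?_
          rw [show z - w - (x - y) = y + z - (x + w) by abel]
        refine DecidedAlong.congr hiff ?_
        rcases hd with ⟨c, hc⟩ | hd
        · by_cases hcz : c < z - w
          · exact Or.inl (eventually_atTop_inf_principal_of_forall fun n hn => (hc n hn).symm ▸ hcz)
          · exact Or.inr (eventually_atTop_inf_principal_of_forall fun n hn h => hcz (hc n hn ▸ h))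
        · exact (hd (z - w)).imp id fun h => h.mono fun n hn => _root_.lt_asymm hn

/-- Every sequence of tuples has a subsequence along which the truth value of each atomic formula,
with any parameters, is eventually constant. -/
theorem exists_decidedAlong [Countable K] {α β : Type*} [Countable α] [Countable β]
    (a : ℕ → α → WithTop G) :
    letI := H.toStructure
    ∃ I : Set ℕ, I.Infinite ∧ ∀ (i : Fin 2) (s t : (langHam K).Term (α ⊕ β)) (b : β → WithTop G),
      DecidedAlong I fun n => topLT (H.lt i) (s.realize (Sum.elim (a n) b))
        (t.realize (Sum.elim (a n) b)) := by
  let := H.toStructure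
  obtain ⟨I, -, hI, hc⟩ := exists_infinite_subset_forall
    (R := fun (t : (langHam K).Term (α ⊕ β)) J =>
      IsControlled J fun (b : β → WithTop G) n => t.realize (Sum.elim (a n) b))
    (fun k I J => IsControlled.mono) Set.infinite_univ
    fun t I _ hI => H.exists_isControlled_term a t hI
  choose S hS hc using hc
  have : ∀ t, Countable (S t) := fun t => (hS t).to_subtype
  -- Only countably many pairs of controlling sequences have to be treated; the parameters survive
  -- merely as `w` and `z`.
  obtain ⟨J, hJI, hJ, h⟩ := exists_infinite_subset_forall
    (ι := Fin 2 × (Σ t, S t) × (Σ t, S t))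
    (R := fun k J => ∀ w z : WithTop G,
      DecidedAlong J fun n => topLT (H.lt k.1) (k.2.1.2.1 n + w) (k.2.2.2.1 n + z))
    (fun k I J hIJ h w z => (h w z).mono hIJ) hI
    fun k I _ hI => H.exists_decidedAlong_lt k.1 _ _ hI
  refine ⟨J, hJ, fun i s t b => ?_⟩
  obtain ⟨x, hx, w, hw⟩ := hc s b
  obtain ⟨y, hy, z, hz⟩ := hc t b
  refine (h ⟨i, ⟨s, x, hx⟩, ⟨t, y, hy⟩⟩ w z).congr ?_
  filter_upwards [(hw.and hz).filter_mono (atTop_inf_principal_le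
    (Set.sdiff_eq_empty.2 hJI ▸ Set.finite_empty : (J \ I).Finite))] with n hn
  rw [hn.1, hn.2]

end HamelSpace

/-! ### Countable saturation of ultrapowers -/

section InternalSets

open Filter

variable {M : Type w} {U : Ultrafilter ℕ}

variable (U) in
/-- The element of an ultrapower that is represented by a sequence. -/
def ultrapowerMk (x : ℕ → M) : (U : Filter ℕ).Product fun _ => M :=
  Quotient.mk ((U : Filter ℕ).productSetoid fun _ => M) x

theorem ultrapowerMk_surjective : Function.Surjective (ultrapowerMk (M := M) U) :=
  Quotient.exists_rep

theorem realize_ultrapowerMk [Nonempty M] {L : FirstOrder.Language.{u, v}} [L.Structure M]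
    {α : Type*} (φ : L.Formula α) (x : α → ℕ → M) :
    φ.Realize (fun a => ultrapowerMk U (x a)) ↔
      ∀ᶠ n in (U : Filter ℕ), φ.Realize fun a => x a n :=
  Ultraproduct.realize_formula_cast φ x

/-- A subset of an ultrapower is internal if it is an ultraproduct of subsets. -/
def IsInternal (S : Set ((U : Filter ℕ).Product fun _ => M)) : Prop :=
  ∃ A : ℕ → Set M, ∀ x : ℕ → M, (ultrapowerMk U x ∈ S ↔ ∀ᶠ n in (U : Filter ℕ), x n ∈ A n)

theorem IsInternal.univ : IsInternal (Set.univ : Set ((U : Filter ℕ).Product fun _ => M)) :=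
  ⟨fun _ => Set.univ, by simp⟩

theorem IsInternal.inter {S T : Set ((U : Filter ℕ).Product fun _ => M)} :
    IsInternal S → IsInternal T → IsInternal (S ∩ T) := by
  rintro ⟨A, hA⟩ ⟨B, hB⟩
  exact ⟨fun n => A n ∩ B n, fun x => by simp [hA, hB, eventually_and]⟩

variable [Nonempty M]

theorem IsInternal.setOf_realize {L : FirstOrder.Language.{u, v}} [L.Structure M] {α : Type*}
    (φ : L.Formula (α ⊕ Unit)) (p : α → (U : Filter ℕ).Product fun _ => M) :
    IsInternal {x | φ.Realize (Sum.elim p fun _ => x)} := by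
  choose q hq using fun a => ultrapowerMk_surjective (p a)
  refine ⟨fun n => {y | φ.Realize (Sum.elim (fun a => q a n) fun _ => y)}, fun x => ?_⟩
  have h := realize_ultrapowerMk (U := U) φ (Sum.elim q fun _ => x)
  have e₁ : (fun a => ultrapowerMk U (Sum.elim q (fun _ : Unit => x) a)) =
      Sum.elim p fun _ => ultrapowerMk U x := by
    funext a
    cases a with
    | inl a => exact hq a
    | inr a => rfl
  have e₂ : ∀ n, (fun a => Sum.elim q (fun _ : Unit => x) a n) =
      Sum.elim (fun a => q a n) fun _ => x n := by
    intro n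
    funext a
    cases a <;> rfl
  simp only [e₁, e₂] at h
  exact h

/-- Ultrapowers over `ℕ` are countably saturated. -/
theorem exists_mem_of_isInternal (hU : (U : Filter ℕ) ≤ atTop) {ι : Type*} [Countable ι]
    (S : ι → Set ((U : Filter ℕ).Product fun _ => M)) (hS : ∀ i, IsInternal (S i))
    (hfin : ∀ F : Finset ι, ∃ x, ∀ i ∈ F, x ∈ S i) : ∃ x, ∀ i, x ∈ S i := by
  classical
  rcases isEmpty_or_nonempty ι with hι | hι
  · obtain ⟨x, -⟩ := hfin ∅
    exact ⟨x, isEmptyElim⟩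
  obtain ⟨e, he⟩ := exists_surjective_nat ι
  choose A hA using hS
  let p : ℕ → ℕ → Prop := fun n k => ∃ y, ∀ j ≤ k, y ∈ A (e j) n
  have hp : ∀ k, ∀ᶠ n in (U : Filter ℕ), p n k := by
    intro k
    obtain ⟨x, hx⟩ := hfin ((Finset.range (k + 1)).image e)
    obtain ⟨x, rfl⟩ := ultrapowerMk_surjective x
    have h1 : ∀ j ∈ Set.Iic k, ∀ᶠ n in (U : Filter ℕ), x n ∈ A (e j) n := fun j hj =>
      (hA _ x).1 (hx _ (Finset.mem_image_of_mem _ (Finset.mem_range_succ_iff.2 hj)))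
    filter_upwards [(eventually_all_finite (Set.finite_Iic k)).2 h1] with n hn
    exact ⟨x n, hn⟩
  -- The `n`-th coordinate satisfies as long an initial segment of the conditions as possible, of
  -- length bounded by `n`. Almost everywhere this segment reaches beyond any given `k`.
  have hy : ∀ n, ∃ y, p n (Nat.findGreatest (p n) n) →
      ∀ j ≤ Nat.findGreatest (p n) n, y ∈ A (e j) n := by
    intro n
    by_cases h : p n (Nat.findGreatest (p n) n)
    · exact h.imp fun y hy _ => hy
    · exact ⟨Classical.arbitrary M, fun h' => absurd h' h⟩
  choose y hy using hy
  refine ⟨ultrapowerMk U y, fun i => ?_⟩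
  obtain ⟨k, rfl⟩ := he i
  rw [hA]
  filter_upwards [hp k, hU (eventually_ge_atTop k)] with n hn hkn
  exact hy n (Nat.findGreatest_spec hkn hn) k (Nat.le_findGreatest hkn hn)

end InternalSets

/-! ### The contradiction in an ultrapower -/

namespace HamelSpace

open Filter Ham

variable {K : Type u} [Field K] [LinearOrder K] [IsStrictOrderedRing K]

/-- The atomic formula `s <_i t`. -/
def ltFormula {α : Type*} (i : Fin 2) (s t : (langHam K).Term α) : (langHam K).Formula α :=
  ltF i (s.relabel Sum.inl) (t.relabel Sum.inl)

theorem realize_ltFormula {G : Type w} [AddCommGroup G] [Module K G] (H : HamelSpace K G)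
    {α : Type*} (i : Fin 2) (s t : (langHam K).Term α) (e : α → WithTop G) :
    letI := H.toStructure
    (ltFormula i s t).Realize e ↔ topLT (H.lt i) (s.realize e) (t.realize e) := by
  let := H.toStructure
  refine (realize_ltF e _ i _ _).trans ?_
  rw [Term.realize_relabel, Term.realize_relabel, Sum.elim_comp_inl]
  rfl

section Saturated

variable {G : Type w} [AddCommGroup G] [Module K G] {H : HamelSpace K G}
  {M : Type*} [Nonempty M] [(langHam K).Structure M] {U : Ultrafilter ℕ}

theorem isCountablySaturated_of_equiv_ultrapower (hU : (U : Filter ℕ) ≤ atTop)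
    (f : letI := H.toStructure
      WithTop G ≃[langHam K] (U : Filter ℕ).Product fun _ => M) :
    H.IsCountablySaturated := by
  let := H.toStructure
  have key : ∀ {α : Type} (φ : (langHam K).Formula (α ⊕ Unit)) (p : α → WithTop G),
      ∃ T : Set ((U : Filter ℕ).Product fun _ => M), IsInternal T ∧
        ∀ x : WithTop G, f x ∈ T ↔ φ.Realize (Sum.elim p fun _ => x) := by
    intro α φ p
    refine ⟨_, IsInternal.setOf_realize φ (f ∘ p), fun x => ?_⟩
    rw [← StrongHomClass.realize_formula f φ, Sum.comp_elim]
    rfl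
  let x₀ : (langHam K).Term (Fin 2 ⊕ Unit) := .var (Sum.inr ())
  let p₀ : Fin 2 → (langHam K).Term (Fin 2 ⊕ Unit) := fun i => .var (Sum.inl i)
  have hbasic : ∀ S : Set G, H.IsBasic S →
      ∃ T : Set ((U : Filter ℕ).Product fun _ => M), IsInternal T ∧
        ∀ x : G, f x ∈ T ↔ x ∈ S := by
    intro S hS
    induction hS with
    | univ => exact ⟨_, IsInternal.univ, by simp⟩
    | inter _ _ ih ih' =>
      obtain ⟨T, hT, hT'⟩ := ih
      obtain ⟨T₂, hT₂, hT₂'⟩ := ih'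
      exact ⟨_, hT.inter hT₂, fun x => by simp [hT', hT₂']⟩
    | lowerBound i b =>
      -- All basic conditions share two parameter slots; unused ones are filled arbitrarily.
      obtain ⟨T, hT, hT'⟩ := key (ltFormula i (p₀ 0) x₀) ![b, b]
      exact ⟨T, hT, fun x => (hT' x).trans ((H.realize_ltFormula i _ _ _).trans topLT_coe)⟩
    | upperBound i b =>
      obtain ⟨T, hT, hT'⟩ := key (ltFormula i x₀ (p₀ 0)) ![b, b]
      exact ⟨T, hT, fun x => (hT' x).trans ((H.realize_ltFormula i _ _ _).trans topLT_coe)⟩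
    | val b g =>
      obtain ⟨T, hT, hT'⟩ := key ((valT (addT x₀ (p₀ 0))).equal (p₀ 1)) ![((-b : G) : WithTop G), g]
      refine ⟨T, hT, fun x => (hT' x).trans ?_⟩
      rw [Formula.realize_equal, realize_valT, realize_addT, Set.mem_ofPred_eq, sub_eq_add_neg]
      rfl
    | value =>
      obtain ⟨T, hT, hT'⟩ := key ((valT x₀).equal x₀) ![⊤, ⊤]
      refine ⟨T, hT, fun x => (hT' x).trans ?_⟩
      rw [Formula.realize_equal, realize_valT]
      rfl
  -- The extra condition `x <_0 ∞` keeps the realization inside `G`.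
  obtain ⟨T₀, hT₀, hT₀'⟩ := key (ltFormula 0 x₀ (p₀ 0)) ![⊤, ⊤]
  intro ι _ S hS hfin
  choose T hT hT' using fun i => hbasic (S i) (hS i)
  obtain ⟨y, hy⟩ := exists_mem_of_isInternal hU (fun i : Option ι => i.elim T₀ T) (by
    rintro (_ | i)
    · exact hT₀
    · exact hT i) (by
    intro F
    obtain ⟨x, hx⟩ := hfin F.eraseNone
    refine ⟨f x, ?_⟩
    rintro (_ | i) hi
    · exact (hT₀' x).2 ((H.realize_ltFormula 0 _ _ _).2 topLT_top)
    · exact (hT' i x).2 (hx i (Finset.mem_eraseNone.2 hi)))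
  obtain ⟨x, rfl⟩ := f.surjective y
  have hx : x ≠ ⊤ := by
    rintro rfl
    exact not_top_topLT ((H.realize_ltFormula 0 _ _ _).1 ((hT₀' _).1 (hy none)))
  obtain ⟨x, rfl⟩ := WithTop.ne_top_iff_exists.1 hx
  exact ⟨x, fun i => (hT' i x).1 (hy (some i))⟩

end Saturated

variable {G : Type w} [AddCommGroup G] [Module K G] {H : HamelSpace K G}

theorem eq_iff_not_topLT (s t : WithTop G) :
    s = t ↔ ¬ topLT (H.lt 0) s t ∧ ¬ topLT (H.lt 0) t s := by
  constructor
  · rintro rfl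
    exact ⟨fun h => H.topLT_asymm h h, fun h => H.topLT_asymm h h⟩
  · rintro ⟨h1, h2⟩
    by_contra h
    exact (H.topLT_total h).elim h1 h2

theorem not_forall_realize_iff_mem [Countable K] (hi : H.IsIndependent) (hd : H.IsDense)
    {α β : Type*} [Countable α] [Countable β] (φ : (langHam K).Formula (α ⊕ β))
    (a : ℕ → α → WithTop G) (b : Set ℕ → β → WithTop G) :
    letI := H.toStructure
    ¬ ∀ (i : ℕ) (J : Set ℕ), φ.Realize (Sum.elim (a i) (b J)) ↔ i ∈ J := by
  let := H.toStructure
  intro hφ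
  obtain ⟨I, hI, hdec⟩ := H.exists_decidedAlong (β := β) a
  classical
  have : Infinite I := hI.to_subtype
  let g := Nat.orderEmbeddingOfSet I
  have hg : ∀ n, g n ∈ I := fun n => Nat.orderEmbeddingOfSet_range I ▸ Set.mem_range_self n
  -- The even positions of the decided subsequence: they and the odd positions are indistinguishable
  -- by atomic formulas over `b J`, but not by `φ`.
  let J : Set ℕ := Set.range fun n => g (2 * n)
  let c : (ℕ → ℕ) → α ⊕ β → ℕ → WithTop G := fun k x n => Sum.elim (a (g (k n))) (b J) x
  let U : Ultrafilter ℕ := hyperfilter ℕ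
  have hU : (U : Filter ℕ) ≤ atTop := Nat.hyperfilter_le_atTop
  let M := (U : Filter ℕ).Product fun _ => WithTop G
  have hM : M ⊨ THam K := by
    have h0 : WithTop G ⊨ THam K := (THam_model_iff_holds _).2 (H.holds hi hd)
    rw [Theory.model_iff] at h0 ⊢
    exact fun ψ hψ => (Ultraproduct.sentence_realize ψ).2 (Eventually.of_forall fun _ => h0 ψ hψ)
  obtain ⟨G', _, _, H', hi', hd', ⟨f⟩⟩ := (THam_models_iff M).1 hM
  let := H'.toStructure
  have hs' : H'.IsCountablySaturated := isCountablySaturated_of_equiv_ultrapower hU f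
  let e : (ℕ → ℕ) → α ⊕ β → WithTop G' := fun k x => f.symm (ultrapowerMk U (c k x))
  have hreal : ∀ (k : ℕ → ℕ) (ψ : (langHam K).Formula (α ⊕ β)), ψ.Realize (e k) ↔
      ∀ᶠ n in (U : Filter ℕ), ψ.Realize (Sum.elim (a (g (k n))) (b J)) := by
    intro k ψ
    rw [← realize_ultrapowerMk ψ (c k)]
    exact StrongHomClass.realize_formula f.symm ψ (v := fun x => ultrapowerMk U (c k x))
  have hlt : ∀ (i : Fin 2) (s t : (langHam K).Term (α ⊕ β)),
      topLT (H'.lt i) (s.realize (e fun n => 2 * n)) (t.realize (e fun n => 2 * n)) ↔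
      topLT (H'.lt i) (s.realize (e fun n => 2 * n + 1)) (t.realize (e fun n => 2 * n + 1)) := by
    intro i s t
    rw [← H'.realize_ltFormula, ← H'.realize_ltFormula, hreal, hreal]
    simp only [H.realize_ltFormula]
    -- Both position sequences tend to infinity within `I`, so both inherit the eventual truth value
    -- of the atomic formula.
    have htend : ∀ k : ℕ → ℕ, StrictMono k →
        Tendsto (fun n => g (k n)) (U : Filter ℕ) (atTop ⊓ 𝓟 I) := fun k hk =>
      (tendsto_inf.2 ⟨g.strictMono.tendsto_atTop.comp hk.tendsto_atTop,
        tendsto_principal.2 (Eventually.of_forall fun n => hg _)⟩).mono_left hU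
    have h2 := htend (fun n => 2 * n) fun m n h => by dsimp only; omega
    have h3 := htend (fun n => 2 * n + 1) fun m n h => by dsimp only; omega
    rcases hdec i s t (b J) with h | h
    · exact iff_of_true (h2.eventually h) (h3.eventually h)
    · exact iff_of_false (Ultrafilter.eventually_not.1 (h2.eventually h))
        (Ultrafilter.eventually_not.1 (h3.eventually h))
  have heq : ∀ s t : (langHam K).Term (α ⊕ β),
      s.realize (e fun n => 2 * n) = t.realize (e fun n => 2 * n) ↔
      s.realize (e fun n => 2 * n + 1) = t.realize (e fun n => 2 * n + 1) := by
    intro s t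
    rw [H'.eq_iff_not_topLT, H'.eq_iff_not_topLT, hlt, hlt]
  have hcontra := H'.realize_iff_of_quantifierFree hi' hd' hs' heq hlt φ
  rw [hreal, hreal] at hcontra
  simp only [hφ] at hcontra
  obtain ⟨n, m, hm⟩ := (hcontra.1 (Eventually.of_forall fun n => ⟨n, rfl⟩)).exists
  have := g.injective hm
  omega

end HamelSpace

/-! ### Reduction to countably many scalars -/

theorem Subfield.countable_closure {C : Type u} [Field C] {s : Set C} (hs : s.Countable) :
    Countable (Subfield.closure s) := by
  rw [← Cardinal.mk_le_aleph0_iff]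
  exact (Subfield.cardinalMk_closure_le_max s).trans (max_le hs.le_aleph0 le_rfl)

section Restriction

variable {C : Type u} [Field C]

/-- The inclusion of the language of Hamel spaces over a subfield. -/
def langHamInclusion (K : Subfield C) : langHam K →ᴸ langHam C where
  onFunction := fun {_} f =>
    match f with
    | .zero => .zero
    | .infty => .infty
    | .add => .add
    | .smul c => .smul (c : C)
    | .val => .val
  onRelation := fun {_} r => r

/-- A term mentions finitely many scalars; countability is a weaker bound that passes through unions
and is all that is needed. -/
theorem exists_countable_scalars_term {α : Type*} (t : (langHam C).Term α) :
    ∃ s : Set C, s.Countable ∧ ∀ K : Subfield C, s ⊆ K →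
      ∃ t' : (langHam K).Term α, (langHamInclusion K).onTerm t' = t := by
  induction t with
  | var a => exact ⟨∅, Set.countable_empty, fun K _ => ⟨.var a, rfl⟩⟩
  | func f ts ih =>
    choose s hs ih using ih
    have hsc : (⋃ i, s i).Countable := Set.countable_iUnion hs
    have ih' : ∀ K : Subfield C, ⋃ i, s i ⊆ K → ∃ ts' : ∀ i, (langHam K).Term α,
        ∀ i, (langHamInclusion K).onTerm (ts' i) = ts i := fun K hK =>
      Classical.skolem.1 fun i => ih i K ((Set.subset_iUnion s i).trans hK)
    cases f with
    | zero =>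
      refine ⟨_, hsc, fun K hK => ?_⟩
      obtain ⟨ts', hts⟩ := ih' K hK
      exact ⟨.func Ham.zeroS ts', congrArg _ (funext hts)⟩
    | infty =>
      refine ⟨_, hsc, fun K hK => ?_⟩
      obtain ⟨ts', hts⟩ := ih' K hK
      exact ⟨.func Ham.inftyS ts', congrArg _ (funext hts)⟩
    | add =>
      refine ⟨_, hsc, fun K hK => ?_⟩
      obtain ⟨ts', hts⟩ := ih' K hK
      exact ⟨.func Ham.addS ts', congrArg _ (funext hts)⟩
    | smul c =>
      refine ⟨_, hsc.insert c, fun K hK => ?_⟩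
      obtain ⟨ts', hts⟩ := ih' K ((Set.subset_insert _ _).trans hK)
      exact ⟨.func (Ham.smulS ⟨c, hK (Set.mem_insert _ _)⟩) ts', congrArg _ (funext hts)⟩
    | val =>
      refine ⟨_, hsc, fun K hK => ?_⟩
      obtain ⟨ts', hts⟩ := ih' K hK
      exact ⟨.func Ham.valS ts', congrArg _ (funext hts)⟩

theorem exists_countable_scalars {α : Type*} {n : ℕ} (φ : (langHam C).BoundedFormula α n) :
    ∃ s : Set C, s.Countable ∧ ∀ K : Subfield C, s ⊆ K →
      ∃ ψ : (langHam K).BoundedFormula α n, (langHamInclusion K).onBoundedFormula ψ = φ := by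
  induction φ with
  | falsum => exact ⟨∅, Set.countable_empty, fun K _ => ⟨.falsum, rfl⟩⟩
  | equal t₁ t₂ =>
    obtain ⟨s₁, hs₁, h₁⟩ := exists_countable_scalars_term t₁
    obtain ⟨s₂, hs₂, h₂⟩ := exists_countable_scalars_term t₂
    refine ⟨s₁ ∪ s₂, hs₁.union hs₂, fun K hK => ?_⟩
    obtain ⟨t₁, rfl⟩ := h₁ K (Set.subset_union_left.trans hK)
    obtain ⟨t₂, rfl⟩ := h₂ K (Set.subset_union_right.trans hK)
    exact ⟨.equal t₁ t₂, rfl⟩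
  | rel R ts =>
    choose s hs h using fun i => exists_countable_scalars_term (ts i)
    refine ⟨⋃ i, s i, Set.countable_iUnion hs, fun K hK => ?_⟩
    choose ts' hts using fun i => h i K ((Set.subset_iUnion s i).trans hK)
    exact ⟨.rel (L := langHam K) R ts', congrArg _ (funext hts)⟩
  | imp _ _ ih₁ ih₂ =>
    obtain ⟨s₁, hs₁, h₁⟩ := ih₁
    obtain ⟨s₂, hs₂, h₂⟩ := ih₂
    refine ⟨s₁ ∪ s₂, hs₁.union hs₂, fun K hK => ?_⟩
    obtain ⟨φ₁, rfl⟩ := h₁ K (Set.subset_union_left.trans hK)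
    obtain ⟨φ₂, rfl⟩ := h₂ K (Set.subset_union_right.trans hK)
    exact ⟨φ₁.imp φ₂, rfl⟩
  | all _ ih =>
    obtain ⟨s, hs, h⟩ := ih
    refine ⟨s, hs, fun K hK => ?_⟩
    obtain ⟨φ, rfl⟩ := h K hK
    exact ⟨φ.all, rfl⟩

variable [LinearOrder C] [IsStrictOrderedRing C]

/-- A Hamel space over `C` is a Hamel space over each subfield of `C`. -/
def HamelSpace.restrict {G : Type w} [AddCommGroup G] [Module C G] (H : HamelSpace C G)
    (K : Subfield C) : HamelSpace K G where
  __ := H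
  smul_pos i c := H.smul_pos i (c : C)
  v_smul c x hc := H.v_smul (c : C) x (by simpa using hc)

theorem HamelSpace.isExpansionOn_langHamInclusion {G : Type w} [AddCommGroup G] [Module C G]
    (H : HamelSpace C G) (K : Subfield C) :
    letI := H.toStructure
    letI := (H.restrict K).toStructure
    (langHamInclusion K).IsExpansionOn (WithTop G) := by
  let := H.toStructure
  let := (H.restrict K).toStructure
  constructor
  · intro n f x
    cases f <;> rfl
  · intro n r x
    cases r
    rfl

end Restriction

theorem mainTheorem9 (C : Type u) [Field C] [LinearOrder C] [IsStrictOrderedRing C] :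
    IsNIP.{u, 0, w} (THam C) := by
  rintro m n φ ⟨M, a, b, h⟩
  obtain ⟨G, _, _, H, hi, hd, ⟨e⟩⟩ := (THam_models_iff M).1 M.is_model
  obtain ⟨s, hs, hφ⟩ := exists_countable_scalars φ
  let K := Subfield.closure s
  have : Countable K := Subfield.countable_closure hs
  obtain ⟨ψ, rfl⟩ := hφ K Subfield.subset_closure
  let := H.toStructure
  let := (H.restrict K).toStructure
  have := H.isExpansionOn_langHamInclusion K
  -- Restricting scalars changes neither the orderings nor the valuation, so independence and
  -- density carry over as they are.
  refine HamelSpace.not_forall_realize_iff_mem (H := H.restrict K) hi hd ψ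
    (fun i => e.symm ∘ a i) (fun J => e.symm ∘ b J) fun i J => ?_
  rw [← h i J, ← StrongHomClass.realize_formula e.symm, Sum.comp_elim]
  exact (LHom.realize_onBoundedFormula (langHamInclusion K) ψ).symm
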